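/- A \emph{bigraph} is a triple $G=(V_1,V_2,E)$ where $V_1,V_2$ are disjoint finite sets (the left and right vertices) and $E\subseteq V_1\times V_2$; write $v_1(G)=|V_1|$ and $e(G)=|E|$. A vertex is isolated if it lies in no edge. Call $G$ a \emph{strong Sidorenko bigraph} if for all probability spaces $(X,\mu)$ and $(Y,\nu)$, every bounded measurable $W:X\times Y\to[0,\infty)$, and all families $(f_v)_{v\in V_1}$ and $(g_w)_{w\in V_2}$ of bounded measurable functions $f_v:X\to[0,\infty)$, $g_w:Y\to[0,\infty)$, we have $$\int_{X^{V_1}\times Y^{V_2}}\ \prod_{v\in V_1}f_v(x_v)\prod_{w\in V_2}g_w(y_w)\prod_{(v,w)\in E}W(x_v,y_w)\ d(\mu^{V_1}\otimes\nu^{V_2})(x,y)\ \ge\ \left(\int_{X\times Y}\ \prod_{v\in V_1}f_v(x)^{1/e(G)}\prod_{w\in V_2}g_w(y)^{1/e(G)}\,W(x,y)\ d(\mu\otimes\nu)(x,y)\right)^{e(G)}.$$ (If $V_1=V_2=\varnothing$, both sides are equal to $1$.) \textbf{Theorem.} Let $G=(V_1,V_2,E)$ be a bigraph without isolated vertices,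 and for each $k\in\mathbb{N}$ let $d_k$ be the number of vertices in $V_2$ of degree $k$. If for each $k\ge 2$ either $d_k=0$ or $d_k\ge\binom{v_1(G)}{k}$, then $G$ is a strong Sidorenko bigraph. -/

import Mathlib

open MeasureTheory

universe u₁ u₂ uX uY

/-- A bigraph: a finite bipartite graph with a fixed bipartition into a left side `V₁` and a
right side `V₂`; an edge is a pair `(v, w)` with `v` a left and `w` a right vertex.  The sides are
two separate types, so they are disjoint by construction; they are assumed finite where used. -/
structure Bigraph (V₁ : Type*) (V₂ : Type*) where
  /-- The edge set `E(G) ⊆ V₁ × V₂`. -/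
  E : Finset (V₁ × V₂)

namespace Bigraph

/-- The number of edges `e(G)`. -/
def e {V₁ V₂ : Type*} (G : Bigraph V₁ V₂) : ℕ := G.E.card

open Classical in
/-- The degree of a left vertex. -/
noncomputable def leftDegree {V₁ V₂ : Type*} [Fintype V₂] (G : Bigraph V₁ V₂) (v : V₁) : ℕ :=
  (Finset.univ.filter fun w : V₂ => (v, w) ∈ G.E).card

open Classical in
/-- The degree of a right vertex. -/
noncomputable def rightDegree {V₁ V₂ : Type*} [Fintype V₁] (G : Bigraph V₁ V₂) (w : V₂) : ℕ :=
  (Finset.univ.filter fun v : V₁ => (v, w) ∈ G.E).card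

/-- No vertex, on either side, has degree zero. -/
def NoIsolatedVertices {V₁ V₂ : Type*} [Fintype V₁] [Fintype V₂] (G : Bigraph V₁ V₂) : Prop :=
  (∀ v : V₁, G.leftDegree v ≠ 0) ∧ (∀ w : V₂, G.rightDegree w ≠ 0)

/-- `d_k`: the number of right vertices of degree `k`. -/
noncomputable def numRightDegree {V₁ V₂ : Type*} [Fintype V₁] [Fintype V₂]
    (G : Bigraph V₁ V₂) (k : ℕ) : ℕ :=
  (Finset.univ.filter fun w : V₂ => G.rightDegree w = k).card

end Bigraph

/-- A bounded measurable function `X → ℝ₊`. -/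
structure IsBoundedWeight {X : Type*} [MeasurableSpace X] (f : X → ℝ) : Prop where
  measurable : Measurable f
  nonneg : ∀ x, 0 ≤ f x
  bounded : ∃ C : ℝ, ∀ x, f x ≤ C

namespace Bigraph

/-- The weighted density `t(G; f, g; W)`, the integral of
`∏_v f_v(x_v) · ∏_w g_w(y_w) · ∏_{(v,w) ∈ E(G)} W(x_v, y_w)` over `X^{V₁} × Y^{V₂}`. -/
noncomputable def weightedDensity {V₁ V₂ : Type*} [Fintype V₁] [Fintype V₂]
    (G : Bigraph V₁ V₂) {X Y : Type*} [MeasurableSpace X] [MeasurableSpace Y]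
    (μ : Measure X) (ν : Measure Y)
    (f : V₁ → X → ℝ) (g : V₂ → Y → ℝ) (W : X × Y → ℝ) : ℝ :=
  ∫ p : (V₁ → X) × (V₂ → Y),
    (∏ v, f v (p.1 v)) * (∏ w, g w (p.2 w)) * (∏ a ∈ G.E, W (p.1 a.1, p.2 a.2))
    ∂((Measure.pi fun _ : V₁ => μ).prod (Measure.pi fun _ : V₂ => ν))

/-- The weighted edge density `t(ρ; ∏_v f_v^{1/e(G)}, ∏_w g_w^{1/e(G)}; W)`. -/
noncomputable def weightedEdgeDensity {V₁ V₂ : Type*} [Fintype V₁] [Fintype V₂]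
    (G : Bigraph V₁ V₂) {X Y : Type*} [MeasurableSpace X] [MeasurableSpace Y]
    (μ : Measure X) (ν : Measure Y)
    (f : V₁ → X → ℝ) (g : V₂ → Y → ℝ) (W : X × Y → ℝ) : ℝ :=
  ∫ p : X × Y,
    (∏ v, f v p.1 ^ (1 / (G.e : ℝ))) * (∏ w, g w p.2 ^ (1 / (G.e : ℝ))) * W p
    ∂(μ.prod ν)

/-- `G` is a strong Sidorenko bigraph: `t(G; f, g; W)` is at least the `e(G)`-th power of
`t(ρ; ∏_v f_v^{1/e(G)}, ∏_w g_w^{1/e(G)}; W)`, for all probability spaces `(X, μ)` and `(Y, ν)`,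
every bigraphon `W` (bounded measurable `X × Y → ℝ₊`) and all families of bounded measurable
weights `f_v : X → ℝ₊`, `g_w : Y → ℝ₊`. -/
def IsStrongSidorenko {V₁ : Type u₁} {V₂ : Type u₂} [Fintype V₁] [Fintype V₂]
    (G : Bigraph V₁ V₂) : Prop :=
  ∀ (X : Type uX) (Y : Type uY) [MeasurableSpace X] [MeasurableSpace Y]
    (μ : Measure X) (ν : Measure Y) [IsProbabilityMeasure μ] [IsProbabilityMeasure ν]
    (W : X × Y → ℝ) (f : V₁ → X → ℝ) (g : V₂ → Y → ℝ),
    IsBoundedWeight W → (∀ v, IsBoundedWeight (f v)) → (∀ w, IsBoundedWeight (g w)) →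
      G.weightedDensity μ ν f g W ≥ G.weightedEdgeDensity μ ν f g W ^ G.e

end Bigraph

/-! Suppose first that both spaces are finite with uniform measure, that there are no vertex
weights, and that `W` is left-regular, scaled so that every left point has mean degree 1. Summing
out the right vertices turns the density into the mean over `x` of the product of the star averages
σ_S(x) = `starAvg W S x`, one factor for each right neighbourhood `S`. The claim is that this mean
is at least 1.

Let ω be the product of σ_S over all sets `S` whose size lies in a set `K`. It is symmetric and
reflection positive in every pair of coordinates. Weighted by ω, Cauchy–Schwarz bounds the square of
the sum for a family of `k`-sets by the product of the sums for its two folds. Foldings percolate to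
the family of all `k`-sets (`percolation`), so that family maximises the sum. By log-convexity and
Jensen, one star is at least as good as none (`sum_mul_le_sum_mul_starAvg`). Hence ω has mean at
least 1, and removing one factor does not increase the mean (`sum_famProd_erase_le`). By 1 - 1/t ≤
log t, the ω-weighted sum of log σ_S is nonnegative; by symmetry it depends only on the size of `S`.
Now let `K` be the set of degrees at least 2 that occur. The product for `G` is ω exp(Δ) ≥ ω (1 +
Δ), where Δ is the difference of the logarithms. The condition on d_k makes the ω-weighted sum of Δ
nonnegative.

For arbitrary finite weights, take `N`th tensor powers and keep the most heavily weighted type class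
of words over `A × B`. It is left-regular by permutation symmetry, and every weight is constant on
it. The loss is polynomial in `N` and disappears in the limit. Arbitrary probability spaces are
reached by sampling `M` points on each side and letting `M` tend to infinity. -/

set_option linter.unusedSectionVars false

/-! ### Reflection positivity and Cauchy–Schwarz -/

section Reflection

variable {V : Type*} {A B : Type} [DecidableEq V] [Fintype V] [Fintype A] [Fintype B]

/-- A function of `x : V → A` that is reflection positive with respect to exchanging the
coordinates `i` and `j`. -/
def IsReflPos (i j : V) (Ψ : (V → A) → ℝ) : Prop :=
  ∃ (Z : Type) (_ : Fintype Z) (U : Z → (V → A) → ℝ),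
    (∀ z x a, U z (Function.update x j a) = U z x) ∧
      ∀ x, Ψ x = ∑ z, U z x * U z (x ∘ Equiv.swap i j)

theorem sum_sum_update (i : V) (h : (V → A) → ℝ) :
    ∑ x : V → A, ∑ a : A, h (Function.update x i a) = Fintype.card A * ∑ x, h x := by
  have hinv : Function.Involutive
      (fun q : (V → A) × A => (Function.update q.1 i q.2, q.1 i)) := by
    intro q
    ext1 <;> simp
  calc ∑ x : V → A, ∑ a : A, h (Function.update x i a)
      = ∑ q : (V → A) × A, h (Function.update q.1 i q.2) := by
        rw [Fintype.sum_prod_type]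
    _ = ∑ q : (V → A) × A, h q.1 :=
        (Equiv.sum_comp (hinv.toPerm _) (fun q : (V → A) × A => h q.1))
    _ = _ := by
        rw [Fintype.sum_prod_type, Finset.mul_sum]
        simp

theorem comp_swap_eq_update (i j : V) (x : V → A) :
    x ∘ Equiv.swap i j = Function.update (Function.update x i (x j)) j (x i) := by
  funext l
  by_cases hj : l = j
  · subst hj; simp
  · by_cases hi : l = i
    · subst hi; simp [Function.update_of_ne hj]
    · simp [Function.update_of_ne hj, Function.update_of_ne hi, Equiv.swap_apply_of_ne_of_ne hi hj]

theorem apply_update_comp_swap {i j : V} (hij : i ≠ j) {P : (V → A) → ℝ}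
    (hP : ∀ x a, P (Function.update x j a) = P x) (x : V → A) (a : A) :
    P (Function.update x j a ∘ Equiv.swap i j) = P (Function.update x i a) := by
  rw [comp_swap_eq_update, hP]
  simp only [Function.update_self]
  rw [Function.update_comm hij.symm, hP]

/-- The first factor sees only the coordinate `i` of the pair and the reflected factor only `j`, so
the two sums separate. The factor |A|² appears because `x` on the right still ranges over the now
irrelevant coordinates `i` and `j`. -/
theorem card_sq_mul_sum_mul_comp_swap {i j : V} (hij : i ≠ j) {P P' : (V → A) → ℝ}
    (hP : ∀ x a, P (Function.update x j a) = P x)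
    (hP' : ∀ x a, P' (Function.update x j a) = P' x) :
    (Fintype.card A : ℝ) ^ 2 * ∑ x, P x * P' (x ∘ Equiv.swap i j) =
      ∑ x, (∑ a, P (Function.update x i a)) * ∑ a, P' (Function.update x i a) := by
  rw [pow_two, mul_assoc, ← sum_sum_update j, Finset.mul_sum]
  simp_rw [hP, apply_update_comp_swap hij hP']
  rw [← Finset.mul_sum, ← sum_sum_update i]
  refine Finset.sum_congr rfl fun x _ => ?_
  rw [Finset.sum_mul]
  refine Finset.sum_congr rfl fun a _ => ?_
  rw [Finset.mul_sum]
  simp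

theorem indep_comp_swap {i j : V} {R : (V → A) → ℝ}
    (hR : ∀ x a, R (Function.update x i a) = R x) (x : V → A) (a : A) :
    R (Function.update x j a ∘ Equiv.swap i j) = R (x ∘ Equiv.swap i j) := by
  by_cases hij : i = j
  · subst hij
    simp [hR]
  · have : Function.update x j a ∘ Equiv.swap i j =
        Function.update (x ∘ Equiv.swap i j) i a := by
      funext l
      by_cases hi : l = i
      · subst hi; simp
      · simp only [Function.comp, Function.update_of_ne hi]
        rw [Function.update_of_ne]
        intro h
        apply hi
        exact (Equiv.swap i j).injective (h.trans (Equiv.swap_apply_left i j).symm)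
    rw [this, hR]

/-- Reflection positivity of Ψ makes (P, P') ↦ ∑ Ψ · P · (P' ∘ swap) a positive semidefinite form on
functions that ignore the coordinate `j`: `key` writes it as a sum of products of partial sums.
Cauchy–Schwarz for this form is applied to `L` and to the reflection of `R`. -/
theorem IsReflPos.sq_sum_le [Nonempty A] {i j : V} (hij : i ≠ j) {Ψ L R : (V → A) → ℝ}
    (hΨ : IsReflPos i j Ψ)
    (hL : ∀ x a, L (Function.update x j a) = L x)
    (hR : ∀ x a, R (Function.update x i a) = R x) :
    (∑ x, Ψ x * (L x * R x)) ^ 2 ≤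
      (∑ x, Ψ x * (L x * L (x ∘ Equiv.swap i j))) *
        ∑ x, Ψ x * (R x * R (x ∘ Equiv.swap i j)) := by
  obtain ⟨Z, _, U, hU, hΨ⟩ := hΨ
  set R' : (V → A) → ℝ := fun x => R (x ∘ Equiv.swap i j) with hR'
  have hR'j : ∀ x a, R' (Function.update x j a) = R' x := fun x a => indep_comp_swap hR x a
  have hinv : ∀ x : V → A, (x ∘ Equiv.swap i j) ∘ Equiv.swap i j = x := by
    intro x; funext l; simp
  have key : ∀ (P P' : (V → A) → ℝ), (∀ x a, P (Function.update x j a) = P x) →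
      (∀ x a, P' (Function.update x j a) = P' x) →
      (Fintype.card A : ℝ) ^ 2 * ∑ x, Ψ x * (P x * P' (x ∘ Equiv.swap i j)) =
        ∑ q : Z × (V → A), (∑ a, U q.1 (Function.update q.2 i a) * P (Function.update q.2 i a)) *
          ∑ a, U q.1 (Function.update q.2 i a) * P' (Function.update q.2 i a) := by
    intro P P' hP hP'
    rw [Fintype.sum_prod_type]
    have : ∀ z, (∑ x : V → A, (∑ a, U z (Function.update x i a) * P (Function.update x i a)) *
          ∑ a, U z (Function.update x i a) * P' (Function.update x i a)) =
        (Fintype.card A : ℝ) ^ 2 * ∑ x, (U z x * P x) *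
          (U z (x ∘ Equiv.swap i j) * P' (x ∘ Equiv.swap i j)) := by
      intro z
      exact (card_sq_mul_sum_mul_comp_swap hij (P := fun x => U z x * P x)
        (P' := fun x => U z x * P' x) (by intro x a; simp only [hU, hP])
        (by intro x a; simp only [hU, hP'])).symm
    simp_rw [this]
    rw [← Finset.mul_sum, Finset.sum_comm]
    congr 1
    refine Finset.sum_congr rfl fun x _ => ?_
    rw [hΨ, Finset.sum_mul]
    refine Finset.sum_congr rfl fun z _ => ?_
    ring
  have h1 := key L R' hL hR'j
  have h2 := key L L hL hL
  have h3 := key R' R' hR'j hR'j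
  have e1 : ∑ x, Ψ x * (L x * R' (x ∘ Equiv.swap i j)) = ∑ x, Ψ x * (L x * R x) := by
    simp only [hR', hinv]
  have e3 : ∑ x, Ψ x * (R' x * R' (x ∘ Equiv.swap i j)) =
      ∑ x, Ψ x * (R x * R (x ∘ Equiv.swap i j)) := by
    simp only [hR', hinv, mul_comm]
  rw [e1] at h1
  rw [e3] at h3
  have hc : (0 : ℝ) < (Fintype.card A : ℝ) ^ 2 := by
    have := Fintype.card_pos (α := A)
    positivity
  have cs := Finset.sum_mul_sq_le_sq_mul_sq (Finset.univ : Finset (Z × (V → A)))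
    (fun q => ∑ a, U q.1 (Function.update q.2 i a) * L (Function.update q.2 i a))
    (fun q => ∑ a, U q.1 (Function.update q.2 i a) * R' (Function.update q.2 i a))
  simp only [pow_two (Finset.sum _ (fun a => U _ _ * _))] at cs
  rw [← h1, ← h2, ← h3, mul_pow] at cs
  refine le_of_mul_le_mul_left ?_ (mul_pos hc hc)
  calc _ = ((Fintype.card A : ℝ) ^ 2) ^ 2 * (∑ x, Ψ x * (L x * R x)) ^ 2 := by ring
    _ ≤ _ := cs
    _ = _ := by ring

theorem IsReflPos.mul {i j : V} {Ψ Ψ' : (V → A) → ℝ} (h : IsReflPos i j Ψ)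
    (h' : IsReflPos i j Ψ') : IsReflPos i j (fun x => Ψ x * Ψ' x) := by
  obtain ⟨Z, _, U, hU, hΨ⟩ := h
  obtain ⟨Z', _, U', hU', hΨ'⟩ := h'
  refine ⟨Z × Z', inferInstance, fun q x => U q.1 x * U' q.2 x, ?_, ?_⟩
  · intro z x a
    simp only [hU, hU']
  · intro x
    simp only [hΨ, hΨ', Finset.sum_mul_sum, Fintype.sum_prod_type]
    refine Finset.sum_congr rfl fun z _ => Finset.sum_congr rfl fun z' _ => ?_
    ring

theorem isReflPos_mul_comp_swap {i j : V} {L : (V → A) → ℝ}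
    (hL : ∀ x a, L (Function.update x j a) = L x) :
    IsReflPos i j (fun x => L x * L (x ∘ Equiv.swap i j)) :=
  ⟨Unit, inferInstance, fun _ => L, fun _ => hL, fun x => by simp⟩

theorem isReflPos_of_indep {i j : V} {c : (V → A) → ℝ} (h0 : ∀ x, 0 ≤ c x)
    (hi : ∀ x a, c (Function.update x i a) = c x)
    (hj : ∀ x a, c (Function.update x j a) = c x) : IsReflPos i j c := by
  refine ⟨Unit, inferInstance, fun _ x => √(c x), fun _ x a => by simp only [hj], fun x => ?_⟩
  simp only [comp_swap_eq_update, hi, hj]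
  simp [Real.mul_self_sqrt (h0 x)]

theorem isReflPos_prod {ι : Type*} {i j : V} (s : Finset ι) {Ψ : ι → (V → A) → ℝ}
    (h : ∀ k ∈ s, IsReflPos i j (Ψ k)) : IsReflPos i j (fun x => ∏ k ∈ s, Ψ k x) := by
  classical
  induction s using Finset.induction_on with
  | empty => exact isReflPos_of_indep (by simp) (by simp) (by simp)
  | insert a s ha ih =>
    simp only [Finset.prod_insert ha]
    exact (h a (by simp)).mul (ih fun k hk => h k (by simp [hk]))

/-! ### Star averages and folding of set families -/

/-- The average over `b` of the weight of the star with centre `b` and leaves `x i`, `i ∈ S`. -/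
noncomputable def starAvg (W : A → B → ℝ) (S : Finset V) (x : V → A) : ℝ :=
  (Fintype.card B : ℝ)⁻¹ * ∑ b, ∏ i ∈ S, W (x i) b

variable {W : A → B → ℝ}

theorem starAvg_nonneg (hW : ∀ a b, 0 ≤ W a b) (S : Finset V) (x : V → A) :
    0 ≤ starAvg W S x :=
  mul_nonneg (by positivity)
    (Finset.sum_nonneg fun _ _ => Finset.prod_nonneg fun _ _ => hW _ _)

theorem starAvg_update {S : Finset V} {j : V} (hj : j ∉ S) (x : V → A) (a : A) :
    starAvg W S (Function.update x j a) = starAvg W S x := by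
  unfold starAvg
  congr 1
  refine Finset.sum_congr rfl fun b _ => Finset.prod_congr rfl fun i hi => ?_
  rw [Function.update_of_ne]
  rintro rfl
  exact hj hi

theorem starAvg_map (e : Equiv.Perm V) (S : Finset V) (x : V → A) :
    starAvg W (S.map e.toEmbedding) x = starAvg W S (x ∘ e) := by
  simp [starAvg]

theorem isReflPos_starAvg (hW : ∀ a b, 0 ≤ W a b) {i j : V} (hij : i ≠ j) {S : Finset V}
    (h : i ∈ S ↔ j ∈ S) : IsReflPos i j (starAvg W S) := by
  by_cases hi : i ∈ S
  · have hj : j ∈ S := h.1 hi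
    -- The star is cut at its centre `b`: the legs at `i` and `j` are mirror images, and the
    -- remaining legs, fixed by the exchange, are shared between the halves by a square root.
    refine ⟨B, inferInstance, fun b x => √((Fintype.card B : ℝ)⁻¹ *
      ∏ l ∈ (S.erase i).erase j, W (x l) b) * W (x i) b, ?_, ?_⟩
    · intro b x a
      simp only [Function.update_of_ne hij]
      congr 3
      refine Finset.prod_congr rfl fun l hl => ?_
      rw [Function.update_of_ne (Finset.ne_of_mem_erase hl)]
    · intro x
      unfold starAvg
      rw [Finset.mul_sum]
      refine Finset.sum_congr rfl fun b _ => ?_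
      have e1 : ∏ l ∈ (S.erase i).erase j, W ((x ∘ Equiv.swap i j) l) b =
          ∏ l ∈ (S.erase i).erase j, W (x l) b := by
        refine Finset.prod_congr rfl fun l hl => ?_
        have hlj := Finset.ne_of_mem_erase hl
        have hli := Finset.ne_of_mem_erase (Finset.mem_of_mem_erase hl)
        simp [Equiv.swap_apply_of_ne_of_ne hli hlj]
      have e2 : ∏ l ∈ S, W (x l) b =
          W (x i) b * (W (x j) b * ∏ l ∈ (S.erase i).erase j, W (x l) b) := by
        rw [Finset.mul_prod_erase _ (fun l => W (x l) b) (by simp [hj, hij.symm]),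
          Finset.mul_prod_erase _ (fun l => W (x l) b) hi]
      have e3 := Real.mul_self_sqrt (x := (Fintype.card B : ℝ)⁻¹ *
        ∏ l ∈ (S.erase i).erase j, W (x l) b)
        (mul_nonneg (by positivity) (Finset.prod_nonneg fun _ _ => hW _ _))
      simp only [e1, e2]
      simp only [Function.comp, Equiv.swap_apply_left]
      linear_combination (-(W (x i) b * W (x j) b)) * e3
  · have hj : j ∉ S := fun h' => hi (h.2 h')
    exact isReflPos_of_indep (starAvg_nonneg hW S) (starAvg_update hi) (starAvg_update hj)

/-- The family obtained from `J` by keeping the sets fixed by the exchange of `i` and `j` and those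
that contain `i` but not `j`, and adding the mirror images of the latter. -/
def foldFamily (i j : V) (J : Finset (Finset V)) : Finset (Finset V) :=
  J.filter (fun S => i ∈ S ↔ j ∈ S) ∪
    (J.filter (fun S => i ∈ S ∧ j ∉ S) ∪
      (J.filter (fun S => i ∈ S ∧ j ∉ S)).map
        (Finset.mapEmbedding (Equiv.swap i j).toEmbedding).toEmbedding)

theorem mem_map_swap {i j : V} {S : Finset V} {l : V} :
    l ∈ S.map (Equiv.swap i j).toEmbedding ↔ Equiv.swap i j l ∈ S := by
  rw [Finset.mem_map_equiv]
  simp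

theorem map_swap_map_swap (i j : V) (S : Finset V) :
    (S.map (Equiv.swap i j).toEmbedding).map (Equiv.swap i j).toEmbedding = S := by
  ext l
  simp

theorem mem_foldFamily {i j : V} {J : Finset (Finset V)} {S : Finset V} :
    S ∈ foldFamily i j J ↔ ((i ∈ S ↔ j ∈ S) ∧ S ∈ J) ∨ ((i ∈ S ∧ j ∉ S) ∧ S ∈ J) ∨
      ((j ∈ S ∧ i ∉ S) ∧ S.map (Equiv.swap i j).toEmbedding ∈ J) := by
  unfold foldFamily
  simp only [Finset.mem_union, Finset.mem_filter, Finset.mem_map]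
  refine or_congr (and_comm) (or_congr (and_comm) ?_)
  constructor
  · rintro ⟨T, ⟨hT, hi, hj⟩, rfl⟩
    simp [hi, hj, map_swap_map_swap, hT]
  · rintro ⟨⟨hj, hi⟩, h⟩
    exact ⟨_, ⟨h, by simpa using hj, by simpa using hi⟩,
      by simp [map_swap_map_swap]⟩

/-- The product of the star averages over a family of sets. -/
noncomputable def famProd (W : A → B → ℝ) (J : Finset (Finset V)) (x : V → A) : ℝ :=
  ∏ S ∈ J, starAvg W S x

theorem famProd_nonneg (hW : ∀ a b, 0 ≤ W a b) (J : Finset (Finset V)) (x : V → A) :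
    0 ≤ famProd W J x :=
  Finset.prod_nonneg fun _ _ => starAvg_nonneg hW _ _

theorem famProd_split (i j : V) (J : Finset (Finset V)) (x : V → A) :
    famProd W J x = famProd W (J.filter (fun S => i ∈ S ↔ j ∈ S)) x *
      (famProd W (J.filter (fun S => i ∈ S ∧ j ∉ S)) x *
        famProd W (J.filter (fun S => j ∈ S ∧ i ∉ S)) x) := by
  unfold famProd
  rw [← Finset.prod_union, ← Finset.prod_union]
  · congr 1
    ext S
    simp only [Finset.mem_union, Finset.mem_filter]
    tauto
  · rw [Finset.disjoint_left]
    simp only [Finset.mem_union, Finset.mem_filter]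
    tauto
  · rw [Finset.disjoint_left]
    simp only [Finset.mem_filter]
    tauto

theorem famProd_foldFamily (i j : V) (J : Finset (Finset V)) (x : V → A) :
    famProd W (foldFamily i j J) x = famProd W (J.filter (fun S => i ∈ S ↔ j ∈ S)) x *
      (famProd W (J.filter (fun S => i ∈ S ∧ j ∉ S)) x *
        famProd W (J.filter (fun S => i ∈ S ∧ j ∉ S)) (x ∘ Equiv.swap i j)) := by
  have h3 : famProd W (J.filter (fun S => i ∈ S ∧ j ∉ S)) (x ∘ Equiv.swap i j) =
      ∏ S ∈ (J.filter (fun S => i ∈ S ∧ j ∉ S)).map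
        (Finset.mapEmbedding (Equiv.swap i j).toEmbedding).toEmbedding, starAvg W S x := by
    rw [Finset.prod_map]
    unfold famProd
    refine Finset.prod_congr rfl fun S _ => ?_
    exact (starAvg_map _ _ _).symm
  rw [h3]
  unfold famProd foldFamily
  rw [Finset.prod_union, Finset.prod_union]
  · rw [Finset.disjoint_left]
    simp only [Finset.mem_map, Finset.mem_filter]
    rintro S ⟨-, hi, -⟩ ⟨T, ⟨-, -, hj⟩, rfl⟩
    simp at hi
    exact hj hi
  · rw [Finset.disjoint_left]
    simp only [Finset.mem_union, Finset.mem_map, Finset.mem_filter]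
    rintro S ⟨-, h⟩ (⟨-, h'⟩ | ⟨T, ⟨-, hi, hj⟩, rfl⟩)
    · tauto
    · simp at h
      tauto

theorem isReflPos_famProd_fixed (hW : ∀ a b, 0 ≤ W a b) {i j : V} (hij : i ≠ j)
    (J : Finset (Finset V)) :
    IsReflPos i j (famProd W (J.filter (fun S => i ∈ S ↔ j ∈ S))) :=
  isReflPos_prod _ fun _ hS => isReflPos_starAvg hW hij (Finset.mem_filter.1 hS).2

theorem famProd_update {J : Finset (Finset V)} {j : V} (hj : ∀ S ∈ J, j ∉ S) (x : V → A) (a : A) :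
    famProd W J (Function.update x j a) = famProd W J x :=
  Finset.prod_congr rfl fun S hS => starAvg_update (hj S hS) x a

theorem isReflPos_famProd (hW : ∀ a b, 0 ≤ W a b) {i j : V} (hij : i ≠ j)
    {J : Finset (Finset V)} (hJ : foldFamily i j J = J) : IsReflPos i j (famProd W J) := by
  rw [← hJ]
  have : famProd W (foldFamily i j J) = _ := funext fun x => famProd_foldFamily i j J x
  rw [this]
  exact (isReflPos_famProd_fixed hW hij J).mul (isReflPos_mul_comp_swap
    (famProd_update fun _ hS => (Finset.mem_filter.1 hS).2.2))

/-- Sets containing only `i` play the role of `L`, those containing only `j` that of `R`. The sets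
fixed by the exchange are reflection positive and join the weight ω. -/
theorem sq_sum_famProd_le [Nonempty A] (hW : ∀ a b, 0 ≤ W a b) {i j : V} (hij : i ≠ j)
    {ω : (V → A) → ℝ} (hω : IsReflPos i j ω) (J : Finset (Finset V)) :
    (∑ x, ω x * famProd W J x) ^ 2 ≤ (∑ x, ω x * famProd W (foldFamily i j J) x) *
      ∑ x, ω x * famProd W (foldFamily j i J) x := by
  have := (hω.mul (isReflPos_famProd_fixed hW hij J)).sq_sum_le hij
    (L := famProd W (J.filter (fun S => i ∈ S ∧ j ∉ S)))
    (R := famProd W (J.filter (fun S => j ∈ S ∧ i ∉ S)))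
    (famProd_update fun _ hS => (Finset.mem_filter.1 hS).2.2)
    (famProd_update fun _ hS => (Finset.mem_filter.1 hS).2.2)
  simp only [famProd_foldFamily]
  simp only [famProd_split (W := W) i j J]
  simp only [iff_comm (a := j ∈ _), Equiv.swap_comm j i, ← mul_assoc] at this ⊢
  exact this

end Reflection

/-! ### Percolation of foldings, and the maximising family -/

section Percolation

variable {V : Type*} {A B : Type} [DecidableEq V] [Fintype V] [Fintype A] [Fintype B]

theorem foldFamily_subset_powersetCard {k : ℕ} {J : Finset (Finset V)} (i j : V)
    (hJ : J ⊆ Finset.univ.powersetCard k) : foldFamily i j J ⊆ Finset.univ.powersetCard k := by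
  intro S hS
  rw [mem_foldFamily] at hS
  rcases hS with ⟨-, h⟩ | ⟨-, h⟩ | ⟨-, h⟩
  · exact hJ h
  · exact hJ h
  · simpa using hJ h

/-- Folding percolates from any nonempty family of `k`-sets to the family of all `k`-sets. -/
theorem percolation {k : ℕ} (P : Finset (Finset V) → Prop)
    (hP : ∀ J, J ⊆ Finset.univ.powersetCard k → P J → ∀ i j, i ≠ j → P (foldFamily i j J))
    {J : Finset (Finset V)} (hJ : J ⊆ Finset.univ.powersetCard k) (hJne : J.Nonempty)
    (hPJ : P J) : P (Finset.univ.powersetCard k) := by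
  -- One new point `j` is adjoined to `U`. Folding with `i`, for `i` running through `I`, gains the
  -- sets that contain `j` and miss `i`, as mirror images of sets that miss `j`. Only sets
  -- containing `j` and all of `I` can still be absent.
  have step : ∀ (U : Finset V) (j : V), j ∉ U → ∀ J, J ⊆ Finset.univ.powersetCard k → P J →
      (∀ S ⊆ U, S.card = k → S ∈ J) → ∀ I ⊆ U, ∃ J', J' ⊆ Finset.univ.powersetCard k ∧ P J' ∧
        ∀ S ⊆ insert j U, S.card = k → ¬ (insert j I ⊆ S) → S ∈ J' := by
    intro U j hj J hJ hPJ hU I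
    induction I using Finset.induction_on with
    | empty =>
      refine fun _ => ⟨J, hJ, hPJ, fun S hS hk hn => hU S ?_ hk⟩
      intro l hl
      rcases Finset.mem_insert.1 (hS hl) with rfl | h
      · exact absurd (by simpa using hl) hn
      · exact h
    | insert i I hi ih =>
      intro hI
      obtain ⟨J', hJ', hPJ', h⟩ := ih ((Finset.subset_insert _ _).trans hI)
      have hiU : i ∈ U := hI (by simp)
      have hij : i ≠ j := by rintro rfl; exact hj hiU
      refine ⟨foldFamily i j J', foldFamily_subset_powersetCard i j hJ',
        hP J' hJ' hPJ' i j hij, fun S hS hk hn => ?_⟩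
      rw [mem_foldFamily]
      by_cases hjS : j ∈ S
      · by_cases hiS : i ∈ S
        · refine Or.inl ⟨by tauto, h S hS hk fun h' => hn ?_⟩
          intro l hl
          simp only [Finset.mem_insert] at hl
          rcases hl with rfl | rfl | hl
          · exact hjS
          · exact hiS
          · exact h' (by simp [hl])
        · refine Or.inr (Or.inr ⟨⟨hjS, hiS⟩, h _ ?_ (by simpa using hk) ?_⟩)
          · intro l hl
            rw [mem_map_swap] at hl
            by_cases hlj : l = j
            · simp [hlj]
            · by_cases hli : l = i
              · simp [hli, hiU]
              · rw [Equiv.swap_apply_of_ne_of_ne hli hlj] at hl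
                exact hS hl
          · intro h'
            have := h' (Finset.mem_insert_self j I)
            rw [mem_map_swap, Equiv.swap_apply_right] at this
            exact hiS this
      · have hSJ : S ∈ J' := h S hS hk fun h' => hjS (h' (by simp))
        by_cases hiS : i ∈ S
        · exact Or.inr (Or.inl ⟨⟨hiS, hjS⟩, hSJ⟩)
        · exact Or.inl ⟨by tauto, hSJ⟩
  obtain ⟨S₀, hS₀⟩ := hJne
  have hc₀ : S₀.card = k := (Finset.mem_powersetCard.1 (hJ hS₀)).2
  have grow : ∀ T : Finset V, ∃ J', J' ⊆ Finset.univ.powersetCard k ∧ P J' ∧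
      ∀ S ⊆ S₀ ∪ T, S.card = k → S ∈ J' := by
    intro T
    induction T using Finset.induction_on with
    | empty =>
      refine ⟨J, hJ, hPJ, fun S hS hk => ?_⟩
      rw [Finset.union_empty] at hS
      rwa [Finset.eq_of_subset_of_card_le hS (by omega)]
    | insert j T _ ih =>
      obtain ⟨J', hJ', hPJ', h⟩ := ih
      rw [Finset.union_insert]
      by_cases hj : j ∈ S₀ ∪ T
      · rw [Finset.insert_eq_of_mem hj]
        exact ⟨J', hJ', hPJ', h⟩
      · obtain ⟨J'', hJ'', hPJ'', h''⟩ := step _ j hj J' hJ' hPJ' h _ subset_rfl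
        -- A set still absent after folding with every `i` would have at least |S₀ ∪ T| + 1 > k
        -- elements.
        refine ⟨J'', hJ'', hPJ'', fun S hS hk => h'' S hS hk fun hn => ?_⟩
        have h1 := Finset.card_le_card hn
        have h2 : S₀.card ≤ (S₀ ∪ T).card := Finset.card_le_card Finset.subset_union_left
        rw [Finset.card_insert_of_notMem hj] at h1
        omega
  obtain ⟨J', hJ', hPJ', h⟩ := grow Finset.univ
  have : J' = Finset.univ.powersetCard k := by
    refine hJ'.antisymm fun S hS => h S ?_ (Finset.mem_powersetCard.1 hS).2
    exact (Finset.subset_univ S).trans Finset.subset_union_right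
  rwa [← this]

/-- If `J` attains the maximum m > 0 of Φ, then m² ≤ Φ(fold) · m, so its folds attain it too.
Maximality thus percolates to the full family. The hypothesis `h1` supplies a nonempty maximiser
when the empty family is one. -/
theorem le_powersetCard_of_sq_le {k : ℕ} (hk : k ≤ Fintype.card V) {Φ : Finset (Finset V) → ℝ}
    (h0 : ∀ J, 0 ≤ Φ J)
    (hΦ : ∀ i j, i ≠ j → ∀ J, Φ J ^ 2 ≤ Φ (foldFamily i j J) * Φ (foldFamily j i J))
    (h1 : ∀ S : Finset V, S.card = k → Φ ∅ ≤ Φ {S})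
    {J : Finset (Finset V)} (hJ : J ⊆ Finset.univ.powersetCard k) :
    Φ J ≤ Φ (Finset.univ.powersetCard k) := by
  obtain ⟨J₀, hJ₀, hmax⟩ := Finset.exists_max_image
    ((Finset.univ.powersetCard k : Finset (Finset V)).powerset) Φ ⟨∅, by simp⟩
  simp only [Finset.mem_powerset] at hJ₀ hmax
  have hmain : ∃ J₁, J₁ ⊆ Finset.univ.powersetCard k ∧ J₁.Nonempty ∧ Φ J₀ ≤ Φ J₁ := by
    rcases J₀.eq_empty_or_nonempty with rfl | hne
    · obtain ⟨S, -, hS⟩ := Finset.exists_subset_card_eq (s := (Finset.univ : Finset V)) (n := k)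
        (by simpa using hk)
      exact ⟨{S}, by simp [hS], by simp, h1 S hS⟩
    · exact ⟨J₀, hJ₀, hne, le_rfl⟩
  obtain ⟨J₁, hJ₁, hne, hle⟩ := hmain
  refine (hmax J hJ).trans (percolation (fun J => Φ J₀ ≤ Φ J) ?_ hJ₁ hne hle)
  intro J hJ hle i j hij
  rcases (h0 J₀).eq_or_lt with h | h
  · rw [← h]; exact h0 _
  · have e1 := hΦ i j hij J
    have e2 := hmax _ (foldFamily_subset_powersetCard j i hJ)
    have e3 := h0 (foldFamily i j J)
    by_contra! hlt
    nlinarith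

variable {W : A → B → ℝ}

/-- For a fixed centre `b`, reflection positivity makes the weighted count `s J b` of stars with
leaf set `J` log-convex as leaves are added. Hence `s {v} b` to the power |S| is at most `s S b`
times `s ∅ b` to the power |S| - 1. Jensen over `b` finishes, since regularity fixes the mean of `s
{v} b`. -/
theorem sum_mul_le_sum_mul_starAvg [Nonempty A] [Nonempty B] (hW : ∀ a b, 0 ≤ W a b)
    (hdeg : ∀ a, ∑ b, W a b = Fintype.card B) {ω : (V → A) → ℝ} (hω0 : ∀ x, 0 ≤ ω x)
    (hω : ∀ i j, i ≠ j → IsReflPos i j ω) {S : Finset V} (hS : S.Nonempty) :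
    ∑ x, ω x ≤ ∑ x, ω x * starAvg W S x := by
  set s : Finset V → B → ℝ := fun J b => ∑ x, ω x * ∏ l ∈ J, W (x l) b with hs
  have hs0 : ∀ J b, 0 ≤ s J b := fun J b => Finset.sum_nonneg fun x _ =>
    mul_nonneg (hω0 x) (Finset.prod_nonneg fun _ _ => hW _ _)
  have hempty : ∀ b, s ∅ b = ∑ x, ω x := fun b => by simp [hs]
  have logconvex : ∀ (J : Finset V) (i j : V) (b : B), i ∉ J → j ∉ J → i ≠ j →
      s (insert i J) b ^ 2 ≤ s (insert j (insert i J)) b * s J b := by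
    intro J i j b hi hj hij
    have hc : IsReflPos i j (fun x : V → A => ∏ l ∈ J, W (x l) b) := by
      refine isReflPos_of_indep (fun x => Finset.prod_nonneg fun _ _ => hW _ _) ?_ ?_
      · intro x a
        refine Finset.prod_congr rfl fun l hl => ?_
        rw [Function.update_of_ne]
        rintro rfl; exact hi hl
      · intro x a
        refine Finset.prod_congr rfl fun l hl => ?_
        rw [Function.update_of_ne]
        rintro rfl; exact hj hl
    have := ((hω i j hij).mul hc).sq_sum_le hij (L := fun x => W (x i) b) (R := fun _ => 1)
      (by intro x a; simp only [Function.update_of_ne hij]) (by simp)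
    simp only [mul_one, Function.comp, Equiv.swap_apply_left] at this
    convert this using 2
    · refine Finset.sum_congr rfl fun x _ => ?_
      rw [Finset.prod_insert hi]; ring
    · refine Finset.sum_congr rfl fun x _ => ?_
      rw [Finset.prod_insert (by simp [hj, hij.symm]), Finset.prod_insert hi]; ring
  obtain ⟨v, hv⟩ := hS
  obtain ⟨T, hvT, rfl⟩ : ∃ T, v ∉ T ∧ S = insert v T :=
    ⟨S.erase v, by simp, (Finset.insert_erase hv).symm⟩
  have ratio : ∀ (b : B) (J : Finset V), v ∉ J → ∀ j, j ∉ J → j ≠ v →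
      s (insert v J) b * s {v} b ≤ s (insert j (insert v J)) b * s ∅ b := by
    intro b J
    induction J using Finset.induction_on with
    | empty =>
      intro _ j _ hjv
      have := logconvex ∅ v j b (by simp) (by simp) hjv.symm
      simpa [pow_two] using this
    | insert i J hi ih =>
      intro hvJ j hj hjv
      simp only [Finset.mem_insert, not_or] at hvJ hj
      have h1 := ih hvJ.2 i hi (Ne.symm hvJ.1)
      have h2 := logconvex (insert v J) i j b (by simp [hi, Ne.symm hvJ.1]) (by simp [hj.2, hjv])
        (Ne.symm hj.1)
      rw [Finset.insert_comm v i J]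
      have p1 := hs0 (insert i (insert v J)) b
      have p2 := hs0 (insert v J) b
      have p3 := hs0 (insert j (insert i (insert v J))) b
      have p4 := hs0 {v} b
      have p5 := hs0 ∅ b
      generalize s (insert i (insert v J)) b = q at *
      generalize s (insert v J) b = r at *
      generalize s (insert j (insert i (insert v J))) b = t at *
      rcases p1.eq_or_lt with h | h
      · rw [← h]; simpa using mul_nonneg p3 p5
      · have hr : 0 < r := by
          rcases p2.eq_or_lt with h' | h'
          · rw [← h'] at h2; nlinarith
          · exact h'
        refine le_of_mul_le_mul_right ?_ hr
        calc q * s {v} b * r = q * (r * s {v} b) := by ring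
          _ ≤ q * (q * s ∅ b) := by gcongr
          _ = q ^ 2 * s ∅ b := by ring
          _ ≤ (t * r) * s ∅ b := by gcongr
          _ = _ := by ring
  have power : ∀ (b : B) (J : Finset V), v ∉ J →
      s {v} b ^ (J.card + 1) ≤ s (insert v J) b * s ∅ b ^ J.card := by
    intro b J
    induction J using Finset.induction_on with
    | empty => simp
    | insert i J hi ih =>
      intro hvJ
      simp only [Finset.mem_insert, not_or] at hvJ
      rw [Finset.card_insert_of_notMem hi, Finset.insert_comm]
      have h1 := ratio b J hvJ.2 i hi (Ne.symm hvJ.1)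
      calc s {v} b ^ (J.card + 1 + 1) = s {v} b ^ (J.card + 1) * s {v} b := pow_succ _ _
        _ ≤ s (insert v J) b * s ∅ b ^ J.card * s {v} b := by
          gcongr
          · exact hs0 _ _
          · exact ih hvJ.2
        _ = s (insert v J) b * s {v} b * s ∅ b ^ J.card := by ring
        _ ≤ s (insert i (insert v J)) b * s ∅ b * s ∅ b ^ J.card := by
          gcongr
          exact pow_nonneg (hs0 _ _) _
        _ = _ := by ring
  set m : ℝ := ∑ x, ω x with hm
  have hm0 : 0 ≤ m := Finset.sum_nonneg fun x _ => hω0 x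
  have hN : (0 : ℝ) < Fintype.card B := by exact_mod_cast Fintype.card_pos
  have hsum1 : ∑ b, s {v} b = Fintype.card B * m := by
    simp only [hs, Finset.prod_singleton]
    rw [Finset.sum_comm]
    simp only [← Finset.mul_sum, hdeg]
    rw [← Finset.sum_mul, mul_comm]
  have hstar : ∑ x, ω x * starAvg W (insert v T) x =
      (Fintype.card B : ℝ)⁻¹ * ∑ b, s (insert v T) b := by
    simp only [hs, starAvg]
    rw [Finset.sum_comm, Finset.mul_sum]
    refine Finset.sum_congr rfl fun x _ => ?_
    rw [← Finset.mul_sum]; ring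
  rw [hstar]
  rcases hm0.eq_or_lt with h | h
  · rw [← h]
    exact mul_nonneg (inv_nonneg.2 hN.le) (Finset.sum_nonneg fun b _ => hs0 _ _)
  · have jensen := pow_sum_div_card_le_sum_pow (s := (Finset.univ : Finset B)) (f := s {v})
      (fun b _ => hs0 _ _) T.card
    have hle : ∑ b, s {v} b ^ (T.card + 1) ≤ (∑ b, s (insert v T) b) * m ^ T.card := by
      rw [Finset.sum_mul]
      refine Finset.sum_le_sum fun b _ => ?_
      simpa [hempty] using power b T hvT
    rw [hsum1, Finset.card_univ] at jensen
    have := jensen.trans hle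
    rw [mul_pow, pow_succ (Fintype.card B : ℝ), mul_assoc, mul_div_cancel_left₀ _ (by positivity),
      pow_succ m, mul_comm (m ^ T.card), ← mul_assoc] at this
    have := le_of_mul_le_mul_right this (by positivity)
    rwa [← div_eq_inv_mul, le_div_iff₀ hN, mul_comm]

end Percolation

/-! ### Symmetric families and the inequality for left-regular `W` -/

section SizeFamily

variable {V : Type*} {A B : Type} [DecidableEq V] [Fintype V] [Fintype A] [Fintype B]
  {W : A → B → ℝ}

/-- The family of all sets whose size lies in `K`. -/
def sizeFamily (V : Type*) [Fintype V] (K : Finset ℕ) : Finset (Finset V) :=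
  Finset.univ.filter fun S => S.card ∈ K

theorem mem_sizeFamily {K : Finset ℕ} {S : Finset V} : S ∈ sizeFamily V K ↔ S.card ∈ K := by
  simp [sizeFamily]

theorem foldFamily_sizeFamily (i j : V) (K : Finset ℕ) :
    foldFamily i j (sizeFamily V K) = sizeFamily V K := by
  ext S
  simp only [mem_foldFamily, mem_sizeFamily, Finset.card_map]
  tauto

/-- The maximisation over families of `k`-sets is carried out with weight `famProd W (sizeFamily V
K)`, which is reflection positive because `sizeFamily V K` is invariant under every folding. -/
theorem sum_famProd_le_of_mem [Nonempty A] [Nonempty B] (hW : ∀ a b, 0 ≤ W a b)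
    (hdeg : ∀ a, ∑ b, W a b = Fintype.card B) {K : Finset ℕ} {k : ℕ} (hk0 : k ≠ 0) (hk : k ∉ K)
    (hkV : k ≤ Fintype.card V)
    {J : Finset (Finset V)} (hJ : J ⊆ Finset.univ.powersetCard k) :
    ∑ x, famProd W (sizeFamily V K ∪ J) x ≤
      ∑ x, famProd W (sizeFamily V (insert k K)) x := by
  have hun : ∀ J : Finset (Finset V), J ⊆ Finset.univ.powersetCard k → ∀ x,
      famProd W (sizeFamily V K ∪ J) x = famProd W (sizeFamily V K) x * famProd W J x := by
    intro J hJ x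
    refine Finset.prod_union (Finset.disjoint_left.2 fun S hS hS' => hk ?_)
    rw [← (Finset.mem_powersetCard.1 (hJ hS')).2]
    exact mem_sizeFamily.1 hS
  have hfull : sizeFamily V (insert k K) = sizeFamily V K ∪ Finset.univ.powersetCard k := by
    ext S
    simp only [mem_sizeFamily, Finset.mem_union, Finset.mem_insert, Finset.mem_powersetCard_univ]
    tauto
  have hRP : ∀ i j : V, i ≠ j → IsReflPos i j (famProd W (sizeFamily V K)) := fun i j hij =>
    isReflPos_famProd hW hij (foldFamily_sizeFamily i j K)
  rw [hfull]
  simp only [hun J hJ, hun _ subset_rfl]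
  refine le_powersetCard_of_sq_le hkV
    (Φ := fun J => ∑ x, famProd W (sizeFamily V K) x * famProd W J x) ?_ ?_ ?_ hJ
  · exact fun J => Finset.sum_nonneg fun x _ =>
      mul_nonneg (famProd_nonneg hW _ x) (famProd_nonneg hW _ x)
  · exact fun i j hij J => sq_sum_famProd_le hW hij (hRP i j hij) J
  · intro S hS
    have hne : S.Nonempty := Finset.card_pos.1 (by omega)
    simpa [famProd] using
      sum_mul_le_sum_mul_starAvg hW hdeg (famProd_nonneg hW (sizeFamily V K)) hRP hne

theorem sizeFamily_insert_of_card_lt {K : Finset ℕ} {k : ℕ} (hkV : Fintype.card V < k) :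
    sizeFamily V (insert k K) = sizeFamily V K := by
  ext S
  have := S.card_le_univ
  simp only [mem_sizeFamily, Finset.mem_insert, or_iff_right_iff_imp]
  omega

theorem card_pow_le_sum_famProd [Nonempty A] [Nonempty B] (hW : ∀ a b, 0 ≤ W a b)
    (hdeg : ∀ a, ∑ b, W a b = Fintype.card B) {K : Finset ℕ} (hK : 0 ∉ K) :
    (Fintype.card A : ℝ) ^ Fintype.card V ≤ ∑ x, famProd W (sizeFamily V K) x := by
  induction K using Finset.induction_on with
  | empty => simp [sizeFamily, famProd]
  | insert k K hk ih =>
    simp only [Finset.mem_insert, not_or] at hK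
    refine (ih hK.2).trans ?_
    rcases le_or_gt k (Fintype.card V) with hkV | hkV
    · simpa using sum_famProd_le_of_mem (V := V) hW hdeg (Ne.symm hK.1) hk hkV
        (Finset.empty_subset _)
    · rw [sizeFamily_insert_of_card_lt hkV]

theorem sum_famProd_erase_le [Nonempty A] [Nonempty B] (hW : ∀ a b, 0 ≤ W a b)
    (hdeg : ∀ a, ∑ b, W a b = Fintype.card B) {K : Finset ℕ} (hK : 0 ∉ K) {S : Finset V}
    (hS : S ∈ sizeFamily V K) :
    ∑ x, famProd W ((sizeFamily V K).erase S) x ≤ ∑ x, famProd W (sizeFamily V K) x := by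
  rw [mem_sizeFamily] at hS
  have h := sum_famProd_le_of_mem (V := V) hW hdeg (K := K.erase S.card) (k := S.card)
    (fun h => hK (h ▸ hS)) (by simp) S.card_le_univ
    (J := (Finset.univ.powersetCard S.card).erase S) (Finset.erase_subset _ _)
  rw [Finset.insert_erase hS] at h
  convert h using 4
  ext T
  simp only [Finset.mem_erase, mem_sizeFamily, Finset.mem_union, Finset.mem_powersetCard_univ]
  by_cases hT : T.card = S.card
  · simp [hT, hS]
  · have : T ≠ S := by rintro rfl; exact hT rfl
    simp [hT, this]

theorem exists_perm_map_eq {S T : Finset V} (h : S.card = T.card) :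
    ∃ e : Equiv.Perm V, S.map e.toEmbedding = T := by
  let e₀ : {x // x ∈ S} ≃ {x // x ∈ T} := Finset.equivOfCardEq h
  refine ⟨e₀.extendSubtype, Finset.eq_of_subset_of_card_le ?_ (by simp [h])⟩
  intro l hl
  obtain ⟨a, ha, rfl⟩ := Finset.mem_map.1 hl
  exact e₀.extendSubtype_mem a ha

theorem famProd_sizeFamily_comp (e : Equiv.Perm V) (K : Finset ℕ) (x : V → A) :
    famProd W (sizeFamily V K) (x ∘ e) = famProd W (sizeFamily V K) x := by
  unfold famProd
  simp only [← starAvg_map]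
  refine Finset.prod_bij' (fun S _ => S.map e.toEmbedding) (fun S _ => S.map e.symm.toEmbedding)
    ?_ ?_ ?_ ?_ ?_
  · simp [mem_sizeFamily]
  · simp [mem_sizeFamily]
  · intro S _; ext; simp
  · intro S _; ext; simp
  · simp

theorem sum_famProd_mul_log_eq (K : Finset ℕ) {S T : Finset V} (h : S.card = T.card) :
    ∑ x, famProd W (sizeFamily V K) x * Real.log (starAvg W S x) =
      ∑ x, famProd W (sizeFamily V K) x * Real.log (starAvg W T x) := by
  obtain ⟨e, rfl⟩ := exists_perm_map_eq h
  simp only [starAvg_map]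
  rw [← Equiv.sum_comp (Equiv.arrowCongr e.symm (Equiv.refl A))]
  refine Finset.sum_congr rfl fun x _ => ?_
  have : Equiv.arrowCongr e.symm (Equiv.refl A) x = x ∘ e := by
    funext l; simp [Equiv.arrowCongr]
  rw [this, famProd_sizeFamily_comp]

/-- Apply 1 - 1/t ≤ log t to t = `starAvg W S x` and compare with the family from which `S` is
erased. Where t = 0 the whole product vanishes, so the default value of `Real.log 0` plays no role.
-/
theorem sum_famProd_mul_log_nonneg [Nonempty A] [Nonempty B] (hW : ∀ a b, 0 ≤ W a b)
    (hdeg : ∀ a, ∑ b, W a b = Fintype.card B) {K : Finset ℕ} (hK : 0 ∉ K) {S : Finset V}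
    (hS : S ∈ sizeFamily V K) :
    0 ≤ ∑ x, famProd W (sizeFamily V K) x * Real.log (starAvg W S x) := by
  have h := sum_famProd_erase_le hW hdeg hK hS
  rw [← sub_nonneg, ← Finset.sum_sub_distrib] at h
  refine h.trans (Finset.sum_le_sum fun x _ => ?_)
  have hmul : starAvg W S x * famProd W ((sizeFamily V K).erase S) x =
      famProd W (sizeFamily V K) x := Finset.mul_prod_erase _ (fun S => starAvg W S x) hS
  have hP := famProd_nonneg hW ((sizeFamily V K).erase S) x
  rcases (starAvg_nonneg hW S x).eq_or_lt with h0 | h0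
  · rw [← hmul, ← h0]; simpa using hP
  · have hlog := Real.one_sub_inv_le_log_of_pos h0
    rw [← hmul]
    calc _ = starAvg W S x * famProd W ((sizeFamily V K).erase S) x * (1 - (starAvg W S x)⁻¹) := by
          field_simp
      _ ≤ _ := by gcongr

theorem starAvg_singleton [Nonempty B] (hdeg : ∀ a, ∑ b, W a b = Fintype.card B) (v : V)
    (x : V → A) : starAvg W {v} x = 1 := by
  have : (Fintype.card B : ℝ) ≠ 0 := by exact_mod_cast Fintype.card_ne_zero
  simp [starAvg, hdeg, this]

/-- The tangent line of exp at 0 compares the product over the neighbourhoods with the symmetric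
product ω. The first-order term is nonnegative because each set size in `K` occurs among the
neighbourhoods at least as often as among all subsets. -/
theorem card_pow_le_sum_prod_starAvg [Nonempty A] [Nonempty B] (hW : ∀ a b, 0 ≤ W a b)
    (hdeg : ∀ a, ∑ b, W a b = Fintype.card B) {R : Type*} [Fintype R] (N : R → Finset V)
    (hN : ∀ w, (N w).Nonempty)
    (hd : ∀ k, 2 ≤ k → (Finset.univ.filter fun w => (N w).card = k).card = 0 ∨
      (Fintype.card V).choose k ≤ (Finset.univ.filter fun w => (N w).card = k).card) :
    (Fintype.card A : ℝ) ^ Fintype.card V ≤ ∑ x : V → A, ∏ w, starAvg W (N w) x := by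
  -- Size 1 is left out: its multiplicity is unrestricted, and by regularity its star averages equal
  -- 1.
  set K : Finset ℕ := (Finset.univ.image fun w => (N w).card).erase 1 with hKdef
  have hKmem : ∀ k, k ∈ K ↔ k ≠ 1 ∧ ∃ w, (N w).card = k := by simp [hKdef]
  have hcard0 : ∀ w, (N w).card ≠ 0 := fun w => (Finset.card_pos.2 (hN w)).ne'
  have hK : 0 ∉ K := by
    rw [hKmem]; rintro ⟨-, w, hw⟩; exact hcard0 w hw
  have hKd : ∀ k ∈ K,
      (Fintype.card V).choose k ≤ (Finset.univ.filter fun w => (N w).card = k).card := by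
    intro k hk
    have h0 : k ≠ 0 := fun h => hK (h ▸ hk)
    obtain ⟨h1, w, hw⟩ := (hKmem k).1 hk
    refine (hd k (by omega)).resolve_left fun h => ?_
    rw [Finset.card_eq_zero] at h
    have : w ∈ (∅ : Finset R) := h ▸ by simp [hw]
    simp at this
  set ω := famProd W (sizeFamily V K) with hω
  set α : Finset V → ℝ := fun S => ∑ x, ω x * Real.log (starAvg W S x) with hα
  have hα1 : ∀ S : Finset V, S.card = 1 → α S = 0 := by
    intro S hS
    obtain ⟨v, rfl⟩ := Finset.card_eq_one.1 hS
    simp [hα, starAvg_singleton hdeg]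
  have hα0 : ∀ S : Finset V, S.card ∈ K → 0 ≤ α S := fun S hS =>
    sum_famProd_mul_log_nonneg hW hdeg hK (mem_sizeFamily.2 hS)
  have hαeq : ∀ S T : Finset V, S.card = T.card → α S = α T := fun S T h =>
    sum_famProd_mul_log_eq K h
  -- Where ω vanishes the left side is 0. Elsewhere every star average involved is positive and the
  -- logarithms are genuine.
  have hpt : ∀ x, ω x * (1 + (∑ w, Real.log (starAvg W (N w) x) -
      ∑ S ∈ sizeFamily V K, Real.log (starAvg W S x))) ≤ ∏ w, starAvg W (N w) x := by
    intro x
    rcases (famProd_nonneg hW (sizeFamily V K) x).eq_or_lt with h | h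
    · rw [hω, ← h, zero_mul]
      exact Finset.prod_nonneg fun _ _ => starAvg_nonneg hW _ _
    · have hpos : ∀ S ∈ sizeFamily V K, 0 < starAvg W S x := fun S hS =>
        lt_of_le_of_ne (starAvg_nonneg hW S x) (Ne.symm (Finset.prod_ne_zero_iff.1 h.ne' S hS))
      have hposN : ∀ w, 0 < starAvg W (N w) x := by
        intro w
        by_cases h1 : (N w).card = 1
        · obtain ⟨v, hv⟩ := Finset.card_eq_one.1 h1
          rw [hv, starAvg_singleton hdeg]
          exact one_pos
        · exact hpos _ (mem_sizeFamily.2 ((hKmem _).2 ⟨h1, w, rfl⟩))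
      have e1 : ∏ w, starAvg W (N w) x = Real.exp (∑ w, Real.log (starAvg W (N w) x)) := by
        rw [Real.exp_sum]
        exact Finset.prod_congr rfl fun w _ => (Real.exp_log (hposN w)).symm
      have e2 : ω x = Real.exp (∑ S ∈ sizeFamily V K, Real.log (starAvg W S x)) := by
        rw [Real.exp_sum]
        exact Finset.prod_congr rfl fun S hS => (Real.exp_log (hpos S hS)).symm
      set p := ∑ w, Real.log (starAvg W (N w) x)
      set q := ∑ S ∈ sizeFamily V K, Real.log (starAvg W S x)
      have e3 : Real.exp p = Real.exp q * Real.exp (p - q) := by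
        rw [← Real.exp_add]; ring_nf
      rw [e1, e2, e3]
      have := Real.add_one_le_exp (p - q)
      gcongr
      linarith
  have hsum : ∑ S ∈ sizeFamily V K, α S ≤ ∑ w, α (N w) := by
    have e1 : ∑ w, α (N w) = ∑ w ∈ Finset.univ.filter (fun w => (N w).card ∈ K), α (N w) := by
      rw [Finset.sum_filter]
      refine Finset.sum_congr rfl fun w _ => ?_
      split_ifs with h
      · rfl
      · refine hα1 _ ?_
        by_contra h1
        exact h ((hKmem _).2 ⟨h1, w, rfl⟩)
    rw [e1, ← Finset.sum_fiberwise_of_maps_to (t := K) (g := fun w => (N w).card) (by simp),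
      ← Finset.sum_fiberwise_of_maps_to (s := sizeFamily V K) (t := K) (g := fun S => S.card)
        (fun S hS => mem_sizeFamily.1 hS)]
    refine Finset.sum_le_sum fun k hk => ?_
    obtain ⟨-, w₀, hw₀⟩ := (hKmem k).1 hk
    have c1 : ∀ S ∈ (sizeFamily V K).filter (fun S => S.card = k), α S = α (N w₀) := fun S hS =>
      hαeq _ _ ((Finset.mem_filter.1 hS).2.trans hw₀.symm)
    have c2 : ∀ w ∈ (Finset.univ.filter (fun w => (N w).card ∈ K)).filter
        (fun w => (N w).card = k), α (N w) = α (N w₀) := fun w hw =>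
      hαeq _ _ ((Finset.mem_filter.1 hw).2.trans hw₀.symm)
    rw [Finset.sum_congr rfl c1, Finset.sum_congr rfl c2, Finset.sum_const, Finset.sum_const,
      nsmul_eq_mul, nsmul_eq_mul]
    have f1 : (sizeFamily V K).filter (fun S => S.card = k) = Finset.univ.powersetCard k := by
      ext S
      simp only [Finset.mem_filter, mem_sizeFamily, Finset.mem_powersetCard_univ]
      constructor
      · exact fun h => h.2
      · rintro rfl; exact ⟨hk, rfl⟩
    have f2 : (Finset.univ.filter (fun w => (N w).card ∈ K)).filter (fun w => (N w).card = k) =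
        Finset.univ.filter (fun w => (N w).card = k) := by
      ext w
      simp only [Finset.mem_filter, Finset.mem_univ, true_and]
      constructor
      · exact fun h => h.2
      · rintro h; exact ⟨h ▸ hk, h⟩
    rw [f1, f2, Finset.card_powersetCard, Finset.card_univ]
    have := hα0 (N w₀) (hw₀ ▸ hk)
    gcongr
    exact hKd k hk
  calc (Fintype.card A : ℝ) ^ Fintype.card V ≤ ∑ x, ω x := card_pow_le_sum_famProd hW hdeg hK
    _ ≤ ∑ x, ω x + (∑ w, α (N w) - ∑ S ∈ sizeFamily V K, α S) := by linarith
    _ = ∑ x, ω x * (1 + (∑ w, Real.log (starAvg W (N w) x) -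
          ∑ S ∈ sizeFamily V K, Real.log (starAvg W S x))) := by
        simp only [hα, mul_add, mul_sub, mul_one, Finset.mul_sum, Finset.sum_add_distrib,
          Finset.sum_sub_distrib]
        rw [Finset.sum_comm, Finset.sum_comm (s := sizeFamily V K)]
    _ ≤ _ := Finset.sum_le_sum fun x _ => hpt x

end SizeFamily

/-! ### Finite bigraphons with arbitrary weights -/

section Finite

namespace Bigraph

open Classical in
/-- The set of left neighbours of a right vertex. -/
noncomputable def leftNbrs {V₁ V₂ : Type*} [Fintype V₁] (G : Bigraph V₁ V₂) (w : V₂) : Finset V₁ :=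
  Finset.univ.filter fun v => (v, w) ∈ G.E

variable {V₁ V₂ : Type*} [Fintype V₁] [Fintype V₂] (G : Bigraph V₁ V₂)

theorem prod_edges_eq {M : Type*} [CommMonoid M] (h : V₁ → V₂ → M) :
    ∏ q ∈ G.E, h q.1 q.2 = ∏ w, ∏ v ∈ G.leftNbrs w, h v w :=
  Finset.prod_finset_product_right _ _ _ (f := fun q => h q.1 q.2) (by simp [leftNbrs])

theorem sum_card_leftNbrs : ∑ w, (G.leftNbrs w).card = G.e := by
  have := Finset.sum_finset_product_right G.E Finset.univ G.leftNbrs (f := fun _ => 1)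
    (by simp [leftNbrs])
  simpa [e] using this.symm

variable {G}

theorem NoIsolatedVertices.exists_right (hG : G.NoIsolatedVertices) (v : V₁) :
    ∃ w, (v, w) ∈ G.E := by
  by_contra! h
  exact hG.1 v (by simp [leftDegree, h])

theorem NoIsolatedVertices.exists_left (hG : G.NoIsolatedVertices) (w : V₂) :
    ∃ v, (v, w) ∈ G.E := by
  by_contra! h
  exact hG.2 w (by simp [rightDegree, h])

theorem NoIsolatedVertices.card_le_e (hG : G.NoIsolatedVertices) : Fintype.card V₁ ≤ G.e := by
  choose w hw using hG.exists_right
  exact Finset.card_le_card_of_injOn (fun v => (v, w v)) (fun v _ => hw v)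
    (fun v _ v' _ h => (Prod.ext_iff.1 h).1)

/-- Scaling `W` by |B| / D gives every left point mean degree 1; summing over `y` factorises over
the right vertices into star averages. -/
theorem card_pow_mul_le_sum_of_regular [DecidableEq V₁] [DecidableEq V₂]
    (hG : G.NoIsolatedVertices)
    (hd : ∀ k : ℕ, 2 ≤ k →
      G.numRightDegree k = 0 ∨ (Fintype.card V₁).choose k ≤ G.numRightDegree k)
    {A B : Type} [Fintype A] [Fintype B] [Nonempty A] [Nonempty B] {W : A → B → ℝ}
    (hW : ∀ a b, 0 ≤ W a b) {D : ℝ} (hD : 0 < D) (hdeg : ∀ a, ∑ b, W a b = D) :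
    (Fintype.card A : ℝ) ^ Fintype.card V₁ * (Fintype.card B : ℝ) ^ Fintype.card V₂ * D ^ G.e ≤
      (∑ x : V₁ → A, ∑ y : V₂ → B, ∏ q ∈ G.E, W (x q.1) (y q.2)) *
        (Fintype.card B : ℝ) ^ G.e := by
  classical
  have hB : (0 : ℝ) < Fintype.card B := by exact_mod_cast Fintype.card_pos
  have main := card_pow_le_sum_prod_starAvg (V := V₁)
    (W := fun a b => (Fintype.card B : ℝ) / D * W a b)
    (fun a b => mul_nonneg (by positivity) (hW a b))
    (fun a => by rw [← Finset.mul_sum, hdeg]; field_simp) G.leftNbrs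
    (fun w => by
      obtain ⟨v, hv⟩ := hG.exists_left w
      exact ⟨v, by simpa [leftNbrs] using hv⟩) hd
  have hx : ∀ x : V₁ → A,
      ∏ w, starAvg (fun a b => (Fintype.card B : ℝ) / D * W a b) (G.leftNbrs w) x =
        ((Fintype.card B : ℝ)⁻¹) ^ Fintype.card V₂ * ((Fintype.card B : ℝ) / D) ^ G.e *
          ∑ y : V₂ → B, ∏ q ∈ G.E, W (x q.1) (y q.2) := by
    intro x
    unfold starAvg
    simp only [Finset.prod_mul_distrib, Finset.prod_const, ← Finset.mul_sum, Finset.card_univ]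
    rw [Finset.prod_pow_eq_pow_sum, G.sum_card_leftNbrs, Finset.prod_univ_sum,
      Fintype.piFinset_univ, mul_assoc]
    congr 2
    refine Finset.sum_congr rfl fun y _ => ?_
    rw [G.prod_edges_eq (fun v w => W (x v) (y w))]
  simp only [hx] at main
  rw [← Finset.mul_sum] at main
  set H := ∑ x : V₁ → A, ∑ y : V₂ → B, ∏ q ∈ G.E, W (x q.1) (y q.2)
  calc _ ≤ (((Fintype.card B : ℝ)⁻¹) ^ Fintype.card V₂ * ((Fintype.card B : ℝ) / D) ^ G.e * H) *
        (Fintype.card B : ℝ) ^ Fintype.card V₂ * D ^ G.e := by gcongr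
    _ = H * (Fintype.card B : ℝ) ^ G.e := by
        rw [inv_pow, div_pow]; field_simp

end Bigraph

/-- The limiting step of the tensor power trick: a polynomial factor cannot compensate an
exponential gap. -/
theorem le_of_forall_pow_le_mul_pow {r P : ℝ} (hP : 0 ≤ P) (s : ℕ)
    (h : ∀ N : ℕ, r ^ N ≤ P ^ N * ((N : ℝ) + 1) ^ s) : r ≤ P := by
  by_contra! hlt
  have hr : 0 < r := hP.trans_lt hlt
  rcases hP.eq_or_lt with h0 | h0
  · have := h 1
    rw [← h0] at this
    norm_num at this
    linarith
  have h1 : |P / r| < 1 := by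
    rw [abs_of_nonneg (by positivity), div_lt_one hr]; exact hlt
  have lim := (tendsto_pow_const_mul_const_pow_of_abs_lt_one s h1).comp (Filter.tendsto_add_atTop_nat 1)
  have : ∀ N : ℕ, P / r ≤ (((N + 1 : ℕ) : ℝ) ^ s * (P / r) ^ (N + 1)) := by
    intro N
    have := h N
    push_cast
    rw [pow_succ (P / r), ← mul_assoc]
    refine le_mul_of_one_le_left (by positivity) ?_
    rw [div_pow, ← mul_div_assoc, le_div_iff₀ (by positivity), one_mul, mul_comm]
    exact this
  have := ge_of_tendsto' lim this
  have : 0 < P / r := by positivity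
  linarith

/-! ### Types of words -/

section Types

variable {Q : Type*} [Fintype Q] [DecidableEq Q] {N : ℕ}

/-- The type of a word: how often each letter occurs. -/
def wordType (p : Fin N → Q) (q : Q) : Fin (N + 1) :=
  ⟨(Finset.univ.filter fun i => p i = q).card,
    Nat.lt_succ_of_le ((Finset.card_le_univ _).trans_eq (Fintype.card_fin N))⟩

theorem wordType_comp (p : Fin N → Q) (σ : Equiv.Perm (Fin N)) :
    wordType (p ∘ σ) = wordType p := by
  funext q
  ext
  simp only [wordType]
  refine Finset.card_bij (fun i _ => σ i) (by simp) (by simp) ?_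
  intro i hi
  exact ⟨σ.symm i, by simpa using hi, by simp⟩

theorem exists_perm_of_wordType_eq {p p' : Fin N → Q} (h : wordType p = wordType p') :
    ∃ σ : Equiv.Perm (Fin N), p' ∘ σ = p := by
  have hc : ∀ q, Nonempty ({i // p i = q} ≃ {i // p' i = q}) := by
    intro q
    refine ⟨Fintype.equivOfCardEq ?_⟩
    have := congrArg Fin.val (congrFun h q)
    simpa [wordType, Fintype.card_subtype] using this
  exact ⟨Equiv.ofFiberEquiv fun q => (hc q).some,
    funext fun i => Equiv.ofFiberEquiv_map _ i⟩

theorem prod_eq_of_wordType_eq {p p' : Fin N → Q} (h : wordType p = wordType p') (φ : Q → ℝ) :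
    ∏ i, φ (p i) = ∏ i, φ (p' i) := by
  obtain ⟨σ, rfl⟩ := exists_perm_of_wordType_eq h
  exact Equiv.prod_comp σ (fun i => φ (p' i))

/-- Pigeonhole: there are at most (N + 1)^|Q| types, and the class of largest total weight is taken.
-/
theorem exists_wordType_le (φ : Q → ℝ) :
    ∃ t : Q → Fin (N + 1), (∑ q, φ q) ^ N ≤
      ((N : ℝ) + 1) ^ Fintype.card Q * ∑ p : Fin N → Q with wordType p = t, ∏ i, φ (p i) := by
  obtain ⟨t, -, ht⟩ := Finset.exists_max_image (Finset.univ : Finset (Q → Fin (N + 1)))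
    (fun t => ∑ p : Fin N → Q with wordType p = t, ∏ i, φ (p i)) Finset.univ_nonempty
  refine ⟨t, ?_⟩
  have e1 : (∑ q, φ q) ^ N = ∑ p : Fin N → Q, ∏ i, φ (p i) := by
    rw [← Fintype.piFinset_univ, ← Finset.prod_univ_sum]
    simp
  rw [e1, ← Finset.sum_fiberwise_of_maps_to (t := Finset.univ) (g := wordType) (by simp)]
  refine (Finset.sum_le_card_nsmul _ _ _ ht).trans_eq ?_
  simp [nsmul_eq_mul]

end Types

/-! ### The tensor power trick -/

namespace Bigraph

variable {V₁ V₂ : Type*} [Fintype V₁] [Fintype V₂] [DecidableEq V₁] [DecidableEq V₂]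
  {G : Bigraph V₁ V₂}

/-- The weight of a pair of vertex maps. -/
def homWeight (G : Bigraph V₁ V₂) {A B : Type*} (f : V₁ → A → ℝ) (g : V₂ → B → ℝ)
    (W : A × B → ℝ) (x : V₁ → A) (y : V₂ → B) : ℝ :=
  (∏ v, f v (x v)) * (∏ w, g w (y w)) * ∏ q ∈ G.E, W (x q.1, y q.2)

theorem homWeight_nonneg {A B : Type*} {f : V₁ → A → ℝ} {g : V₂ → B → ℝ}
    {W : A × B → ℝ} (hf : ∀ v a, 0 ≤ f v a) (hg : ∀ w b, 0 ≤ g w b) (hW : ∀ q, 0 ≤ W q)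
    (x : V₁ → A) (y : V₂ → B) : 0 ≤ G.homWeight f g W x y :=
  mul_nonneg (mul_nonneg (Finset.prod_nonneg fun _ _ => hf _ _)
    (Finset.prod_nonneg fun _ _ => hg _ _)) (Finset.prod_nonneg fun _ _ => hW _)

theorem sum_homWeight_pow {A B : Type} [Fintype A] [Fintype B] (f : V₁ → A → ℝ)
    (g : V₂ → B → ℝ) (W : A × B → ℝ) (N : ℕ) :
    (∑ x : V₁ → A, ∑ y : V₂ → B, G.homWeight f g W x y) ^ N =
      ∑ x : V₁ → Fin N → A, ∑ y : V₂ → Fin N → B,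
        ∏ i, G.homWeight f g W (fun v => x v i) (fun w => y w i) := by
  classical
  rw [← Fintype.sum_prod_type', ← Fintype.sum_prod_type']
  have : (∑ q : (V₁ → A) × (V₂ → B), G.homWeight f g W q.1 q.2) ^ N =
      ∏ _i : Fin N, ∑ q : (V₁ → A) × (V₂ → B), G.homWeight f g W q.1 q.2 := by simp
  rw [this, Finset.prod_univ_sum, Fintype.piFinset_univ]
  let E : (Fin N → (V₁ → A) × (V₂ → B)) ≃ (V₁ → Fin N → A) × (V₂ → Fin N → B) :=
    (Equiv.arrowProdEquivProdArrow _ _ _).trans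
      ((Equiv.piComm _).prodCongr (Equiv.piComm _))
  exact Fintype.sum_equiv E _ _ fun q => rfl

/-- The regular inequality is applied to the indicator of the heaviest type class `C`, seen as a
bipartite graph from its left words `L` to all right words. On `C` each coordinate product is
constant, so each homomorphism into `C` has weight κ^e(G), while |C| = |L| · D. -/
theorem sum_homWeight_pow_ge (hG : G.NoIsolatedVertices)
    (hd : ∀ k : ℕ, 2 ≤ k →
      G.numRightDegree k = 0 ∨ (Fintype.card V₁).choose k ≤ G.numRightDegree k)
    {A B : Type} [Fintype A] [Fintype B] [Nonempty A] [Nonempty B]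
    {f : V₁ → A → ℝ} {g : V₂ → B → ℝ} {W : A × B → ℝ}
    (hf : ∀ v a, 0 ≤ f v a) (hg : ∀ w b, 0 ≤ g w b) (hW : ∀ q, 0 ≤ W q)
    {F : A → ℝ} {H : B → ℝ} (hF0 : ∀ a, 0 ≤ F a) (hH0 : ∀ b, 0 ≤ H b)
    (hF : ∀ a, F a ^ G.e = ∏ v, f v a) (hH : ∀ b, H b ^ G.e = ∏ w, g w b)
    (hZ : 0 < ∑ q : A × B, F q.1 * H q.2 * W q) (N : ℕ) :
    ((∑ q : A × B, F q.1 * H q.2 * W q) ^ G.e * (Fintype.card A : ℝ) ^ Fintype.card V₁ *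
      (Fintype.card B : ℝ) ^ Fintype.card V₂) ^ N ≤
    ((∑ x : V₁ → A, ∑ y : V₂ → B, G.homWeight f g W x y) *
      (Fintype.card A : ℝ) ^ G.e * (Fintype.card B : ℝ) ^ G.e) ^ N *
        ((N : ℝ) + 1) ^ (Fintype.card (A × B) * G.e) := by
  classical
  obtain ⟨t, ht⟩ := exists_wordType_le (N := N) (fun q : A × B => F q.1 * H q.2 * W q)
  set Z := ∑ q : A × B, F q.1 * H q.2 * W q with hZdef
  set T := ∑ x : V₁ → A, ∑ y : V₂ → B, G.homWeight f g W x y with hT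
  set C : Finset (Fin N → A × B) := Finset.univ.filter fun p => wordType p = t with hC
  have hCne : C.Nonempty := by
    rw [Finset.nonempty_iff_ne_empty]
    intro h
    rw [h, Finset.sum_empty, mul_zero] at ht
    exact absurd ht (not_le.2 (by positivity))
  obtain ⟨p₀, hp₀⟩ := hCne
  have hconst : ∀ p ∈ C, ∀ φ : A × B → ℝ, ∏ i, φ (p i) = ∏ i, φ (p₀ i) := fun p hp φ =>
    prod_eq_of_wordType_eq ((Finset.mem_filter.1 hp).2.trans (Finset.mem_filter.1 hp₀).2.symm) φ
  set κ := ∏ i, (F (p₀ i).1 * H (p₀ i).2 * W (p₀ i)) with hκ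
  have hκ0 : 0 ≤ κ := Finset.prod_nonneg fun i _ =>
    mul_nonneg (mul_nonneg (hF0 _) (hH0 _)) (hW _)
  rw [Finset.sum_congr rfl fun p hp => hconst p hp (fun q => F q.1 * H q.2 * W q),
    Finset.sum_const, nsmul_eq_mul, ← hκ] at ht
  -- left words that occur in the type class
  set L : Finset (Fin N → A) := C.image fun p i => (p i).1 with hL
  let zip : (Fin N → A) → (Fin N → B) → Fin N → A × B := fun a b i => (a i, b i)
  let d : (Fin N → A) → ℕ := fun a => (Finset.univ.filter fun b => zip a b ∈ C).card
  set D := d fun i => (p₀ i).1 with hD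
  -- Two words of `C` differ by a permutation of positions, which preserves `C` and so matches the
  -- right extensions of their left words.
  have hdL : ∀ a ∈ L, d a = D := by
    intro a ha
    obtain ⟨p, hp, rfl⟩ := Finset.mem_image.1 ha
    obtain ⟨σ, hσ⟩ := exists_perm_of_wordType_eq
      ((Finset.mem_filter.1 hp₀).2.trans (Finset.mem_filter.1 hp).2.symm)
    rw [hD, ← hσ]
    refine Finset.card_bij' (fun b _ => b ∘ σ) (fun b _ => b ∘ σ.symm) ?_ ?_ ?_ ?_
    · intro b hb
      simp only [Finset.mem_filter, Finset.mem_univ, true_and, hC] at hb ⊢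
      rw [← hb, ← wordType_comp (zip (fun i => (p i).1) b) σ]
      rfl
    · intro b hb
      simp only [Finset.mem_filter, Finset.mem_univ, true_and, hC] at hb ⊢
      rw [← hb, ← wordType_comp _ σ]
      congr 1
      funext i
      simp [zip]
    · intro b _; funext i; simp
    · intro b _; funext i; simp
  have hCcard : C.card = L.card * D := by
    rw [Finset.card_eq_sum_card_fiberwise (f := fun p i => (p i).1) (t := L)
      (fun p hp => Finset.mem_coe.2 (Finset.mem_image_of_mem _ hp)), ← smul_eq_mul,
      ← Finset.sum_const]
    refine Finset.sum_congr rfl fun a ha => ?_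
    rw [← hdL a ha]
    refine Finset.card_bij' (fun p _ i => (p i).2) (fun b _ => zip a b) ?_ ?_ ?_ ?_
    · intro p hp
      obtain ⟨hp, rfl⟩ := Finset.mem_filter.1 hp
      simpa [zip] using hp
    · intro b hb
      simpa [zip] using hb
    · intro p hp
      obtain ⟨hp, rfl⟩ := Finset.mem_filter.1 hp
      rfl
    · intro b _; rfl
  have hDpos : 0 < D := by
    rcases Nat.eq_zero_or_pos D with h | h
    · have := Finset.card_pos.2 ⟨p₀, hp₀⟩
      rw [hCcard, h] at this
      simp at this
    · exact h
  have : Nonempty {a // a ∈ L} := ⟨⟨_, Finset.mem_image_of_mem _ hp₀⟩⟩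
  have core := card_pow_mul_le_sum_of_regular hG hd (A := {a // a ∈ L}) (B := Fin N → B)
    (W := fun a b => if zip a.1 b ∈ C then 1 else 0) (D := D)
    (fun a b => by positivity) (by exact_mod_cast hDpos)
    (fun a => by rw [Finset.sum_boole, ← hdL a.1 a.2])
  have hhom : κ ^ G.e * (∑ x : V₁ → {a // a ∈ L}, ∑ y : V₂ → Fin N → B,
      ∏ q ∈ G.E, if zip (x q.1).1 (y q.2) ∈ C then (1 : ℝ) else 0) ≤ T ^ N := by
    rw [hT, sum_homWeight_pow, Finset.mul_sum]
    have hinj : Function.Injective (fun (x : V₁ → {a // a ∈ L}) v => (x v).1) :=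
      fun x x' h => funext fun v => Subtype.ext (congrFun h v)
    have hle : ∀ Φ : (V₁ → Fin N → A) → ℝ, (∀ x, 0 ≤ Φ x) →
        ∑ x : V₁ → {a // a ∈ L}, Φ (fun v => (x v).1) ≤ ∑ x, Φ x := by
      intro Φ hΦ
      rw [← Finset.sum_image (f := Φ) (g := fun (x : V₁ → {a // a ∈ L}) v => (x v).1)
        hinj.injOn]
      exact Finset.sum_le_univ_sum_of_nonneg hΦ
    have hnn : ∀ (x : V₁ → Fin N → A) (y : V₂ → Fin N → B),
        0 ≤ ∏ i, G.homWeight f g W (fun v => x v i) (fun w => y w i) := fun x y =>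
      Finset.prod_nonneg fun i _ => homWeight_nonneg hf hg hW _ _
    refine le_trans ?_ (hle _ fun x => Finset.sum_nonneg fun y _ => hnn x y)
    refine Finset.sum_le_sum fun x _ => ?_
    rw [Finset.mul_sum]
    refine Finset.sum_le_sum fun y _ => ?_
    by_cases hall : ∀ q ∈ G.E, zip (x q.1).1 (y q.2) ∈ C
    · rw [Finset.prod_congr rfl fun q hq => if_pos (hall q hq), Finset.prod_const_one, mul_one]
      apply le_of_eq
      unfold homWeight
      rw [Finset.prod_mul_distrib, Finset.prod_mul_distrib, Finset.prod_comm,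
        Finset.prod_comm (s := Finset.univ) (t := Finset.univ) (f := fun i w => g w (y w i)),
        Finset.prod_comm (s := Finset.univ) (t := G.E)]
      -- Every vertex lies on an edge, so its word is one coordinate of a word of `C` and its weight
      -- product is the one read off from `p₀`.
      have e1 : ∀ v, ∏ i, f v ((x v).1 i) = ∏ i, f v (p₀ i).1 := by
        intro v
        obtain ⟨w, hw⟩ := hG.exists_right v
        exact hconst _ (hall _ hw) (fun q => f v q.1)
      have e2 : ∀ w, ∏ i, g w (y w i) = ∏ i, g w (p₀ i).2 := by
        intro w
        obtain ⟨v, hv⟩ := hG.exists_left w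
        exact hconst _ (hall _ hv) (fun q => g w q.2)
      have e3 : ∀ q ∈ G.E, ∏ i, W ((x q.1).1 i, y q.2 i) = ∏ i, W (p₀ i) := fun q hq =>
        hconst _ (hall q hq) W
      rw [Finset.prod_congr rfl e3, Finset.prod_congr rfl fun v _ => e1 v,
        Finset.prod_congr rfl fun w _ => e2 w, Finset.prod_const, Finset.prod_comm,
        Finset.prod_comm (s := Finset.univ) (t := Finset.univ) (f := fun w i => g w (p₀ i).2)]
      simp only [← hF, ← hH]
      rw [hκ, Finset.prod_mul_distrib, Finset.prod_mul_distrib, mul_pow, mul_pow,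
        Finset.prod_pow, Finset.prod_pow]
      rfl
    · push Not at hall
      obtain ⟨q, hq, hqC⟩ := hall
      rw [Finset.prod_eq_zero hq (if_neg hqC), mul_zero]
      exact hnn _ _
  have hLle : (L.card : ℝ) ≤ (Fintype.card A : ℝ) ^ N := by
    have := L.card_le_univ
    rw [Fintype.card_fun, Fintype.card_fin] at this
    exact_mod_cast this
  -- Passing from the uniform measure on `L` to that on all left words costs nothing here: |L| ≤
  -- |A|^N and |V₁| ≤ e(G).
  have hpow : (L.card : ℝ) ^ G.e * ((Fintype.card A : ℝ) ^ N) ^ Fintype.card V₁ ≤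
      (L.card : ℝ) ^ Fintype.card V₁ * ((Fintype.card A : ℝ) ^ N) ^ G.e := by
    obtain ⟨k, hk⟩ := Nat.exists_eq_add_of_le hG.card_le_e
    rw [hk, pow_add, pow_add]
    calc _ = (L.card : ℝ) ^ Fintype.card V₁ * ((Fintype.card A : ℝ) ^ N) ^ Fintype.card V₁ *
          (L.card : ℝ) ^ k := by ring
      _ ≤ (L.card : ℝ) ^ Fintype.card V₁ * ((Fintype.card A : ℝ) ^ N) ^ Fintype.card V₁ *
          ((Fintype.card A : ℝ) ^ N) ^ k := by gcongr
      _ = _ := by ring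
  simp only [Fintype.card_coe, Fintype.card_fun, Fintype.card_fin, Nat.cast_pow] at core
  rw [hCcard] at ht
  push_cast at ht
  set S := ∑ x : V₁ → {a // a ∈ L}, ∑ y : V₂ → Fin N → B,
      ∏ q ∈ G.E, if zip (x q.1).1 (y q.2) ∈ C then (1 : ℝ) else 0 with hS
  set α := (Fintype.card A : ℝ)
  set β := (Fintype.card B : ℝ)
  set n := Fintype.card V₁
  set m := Fintype.card V₂
  set s := Fintype.card (A × B)
  calc (Z ^ G.e * α ^ n * β ^ m) ^ N = (Z ^ N) ^ G.e * (α ^ N) ^ n * (β ^ N) ^ m := by ring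
    _ ≤ (((N : ℝ) + 1) ^ s * (L.card * D * κ)) ^ G.e * (α ^ N) ^ n * (β ^ N) ^ m := by
        gcongr
    _ = ((N : ℝ) + 1) ^ (s * G.e) * κ ^ G.e * D ^ G.e * (β ^ N) ^ m *
          (L.card ^ G.e * (α ^ N) ^ n) := by ring
    _ ≤ ((N : ℝ) + 1) ^ (s * G.e) * κ ^ G.e * D ^ G.e * (β ^ N) ^ m *
          (L.card ^ n * (α ^ N) ^ G.e) := by gcongr
    _ = ((N : ℝ) + 1) ^ (s * G.e) * κ ^ G.e * (α ^ N) ^ G.e *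
          (L.card ^ n * (β ^ N) ^ m * D ^ G.e) := by ring
    _ ≤ ((N : ℝ) + 1) ^ (s * G.e) * κ ^ G.e * (α ^ N) ^ G.e * (S * (β ^ N) ^ G.e) := by gcongr
    _ = ((N : ℝ) + 1) ^ (s * G.e) * (α ^ N) ^ G.e * (β ^ N) ^ G.e * (κ ^ G.e * S) := by ring
    _ ≤ ((N : ℝ) + 1) ^ (s * G.e) * (α ^ N) ^ G.e * (β ^ N) ^ G.e * T ^ N := by gcongr
    _ = _ := by ring

theorem finite_strongSidorenko (hG : G.NoIsolatedVertices)
    (hd : ∀ k : ℕ, 2 ≤ k →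
      G.numRightDegree k = 0 ∨ (Fintype.card V₁).choose k ≤ G.numRightDegree k)
    (he : G.e ≠ 0)
    {A B : Type} [Fintype A] [Fintype B] [Nonempty A] [Nonempty B]
    {f : V₁ → A → ℝ} {g : V₂ → B → ℝ} {W : A × B → ℝ}
    (hf : ∀ v a, 0 ≤ f v a) (hg : ∀ w b, 0 ≤ g w b) (hW : ∀ q, 0 ≤ W q)
    {F : A → ℝ} {H : B → ℝ} (hF0 : ∀ a, 0 ≤ F a) (hH0 : ∀ b, 0 ≤ H b)
    (hF : ∀ a, F a ^ G.e = ∏ v, f v a) (hH : ∀ b, H b ^ G.e = ∏ w, g w b) :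
    (∑ q : A × B, F q.1 * H q.2 * W q) ^ G.e * (Fintype.card A : ℝ) ^ Fintype.card V₁ *
      (Fintype.card B : ℝ) ^ Fintype.card V₂ ≤
    (∑ x : V₁ → A, ∑ y : V₂ → B, G.homWeight f g W x y) *
      (Fintype.card A : ℝ) ^ G.e * (Fintype.card B : ℝ) ^ G.e := by
  have hT : 0 ≤ ∑ x : V₁ → A, ∑ y : V₂ → B, G.homWeight f g W x y :=
    Finset.sum_nonneg fun x _ => Finset.sum_nonneg fun y _ => homWeight_nonneg hf hg hW x y
  have hZ0 : 0 ≤ ∑ q : A × B, F q.1 * H q.2 * W q :=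
    Finset.sum_nonneg fun q _ => mul_nonneg (mul_nonneg (hF0 _) (hH0 _)) (hW _)
  rcases hZ0.eq_or_lt with hZ | hZ
  · rw [← hZ, zero_pow he, zero_mul, zero_mul]
    positivity
  · exact le_of_forall_pow_le_mul_pow (by positivity) _
      (sum_homWeight_pow_ge hG hd hf hg hW hF0 hH0 hF hH hZ)

end Bigraph

end Finite

/-! ### From finite spaces to probability spaces by sampling -/

section Sampling

theorem measurePreserving_comp_injective {V ι X : Type*} [Fintype V] [Fintype ι]
    [MeasurableSpace X] (μ : Measure X) [IsProbabilityMeasure μ] {u : V → ι}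
    (hu : Function.Injective u) :
    MeasurePreserving (fun a : ι → X => a ∘ u) (Measure.pi fun _ => μ) (Measure.pi fun _ => μ) := by
  have hmeas : Measurable (fun a : ι → X => a ∘ u) :=
    measurable_pi_lambda _ fun v => measurable_pi_apply _
  refine ⟨hmeas, (Measure.pi_eq fun s hs => ?_).symm⟩
  rw [Measure.map_apply hmeas (MeasurableSet.univ_pi hs)]
  have hpre : (fun a : ι → X => a ∘ u) ⁻¹' (Set.univ.pi s) =
      Set.univ.pi fun k => ⋂ v, ⋂ (_ : u v = k), s v := by
    ext a
    simp only [Set.mem_preimage, Set.mem_univ_pi, Set.mem_iInter, Function.comp]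
    constructor
    · rintro h k v rfl; exact h v
    · intro h v; exact h _ v rfl
  rw [hpre, Measure.pi_pi]
  refine (Fintype.prod_of_injective u hu _ _ ?_ ?_).symm
  · intro k hk
    have : (⋂ v, ⋂ (_ : u v = k), s v) = Set.univ := by
      simp only [Set.iInter_eq_univ]
      exact fun v hv => absurd ⟨v, hv⟩ hk
    rw [this, measure_univ]
  · intro v
    congr 1
    ext a
    simp only [Set.mem_iInter]
    exact ⟨fun h v' hv' => by rwa [hu hv'], fun h => h v rfl⟩

theorem IsBoundedWeight.integrable {X : Type*} [MeasurableSpace X] {f : X → ℝ}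
    (hf : IsBoundedWeight f) (μ : Measure X) [IsFiniteMeasure μ] : Integrable f μ := by
  obtain ⟨C, hC⟩ := hf.bounded
  refine Integrable.of_bound hf.measurable.aestronglyMeasurable C (Filter.Eventually.of_forall ?_)
  intro x
  rw [Real.norm_of_nonneg (hf.nonneg x)]
  exact hC x

theorem IsBoundedWeight.comp {X Y : Type*} [MeasurableSpace X] [MeasurableSpace Y] {f : X → ℝ}
    (hf : IsBoundedWeight f) {φ : Y → X} (hφ : Measurable φ) : IsBoundedWeight fun y => f (φ y) :=
  ⟨hf.measurable.comp hφ, fun _ => hf.nonneg _, hf.bounded.imp fun _ h _ => h _⟩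

theorem IsBoundedWeight.mul {X : Type*} [MeasurableSpace X] {f g : X → ℝ}
    (hf : IsBoundedWeight f) (hg : IsBoundedWeight g) : IsBoundedWeight fun x => f x * g x := by
  obtain ⟨C, hC⟩ := hf.bounded
  obtain ⟨D, hD⟩ := hg.bounded
  exact ⟨hf.measurable.mul hg.measurable, fun x => mul_nonneg (hf.nonneg x) (hg.nonneg x),
    C * D, fun x => mul_le_mul (hC x) (hD x) (hg.nonneg x) ((hf.nonneg x).trans (hC x))⟩

theorem isBoundedWeight_prod {X ι : Type*} [MeasurableSpace X] (s : Finset ι) {f : ι → X → ℝ}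
    (hf : ∀ i ∈ s, IsBoundedWeight (f i)) : IsBoundedWeight fun x => ∏ i ∈ s, f i x := by
  classical
  induction s using Finset.induction_on with
  | empty => exact ⟨by simp [measurable_const], by simp, 1, by simp⟩
  | insert i s hi ih =>
    simp only [Finset.prod_insert hi]
    exact (hf i (by simp)).mul (ih fun k hk => hf k (by simp [hk]))

theorem IsBoundedWeight.rpow {X : Type*} [MeasurableSpace X] {f : X → ℝ}
    (hf : IsBoundedWeight f) {r : ℝ} (hr : 0 ≤ r) : IsBoundedWeight fun x => f x ^ r := by
  obtain ⟨C, hC⟩ := hf.bounded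
  exact ⟨hf.measurable.pow_const r, fun x => Real.rpow_nonneg (hf.nonneg x) r,
    C ^ r, fun x => Real.rpow_le_rpow (hf.nonneg x) (hC x) hr⟩

theorem isBoundedWeight_sum {X ι : Type*} [MeasurableSpace X] (s : Finset ι) {f : ι → X → ℝ}
    (hf : ∀ i ∈ s, IsBoundedWeight (f i)) : IsBoundedWeight fun x => ∑ i ∈ s, f i x := by
  refine ⟨Finset.measurable_sum _ fun i hi => (hf i hi).measurable,
    fun x => Finset.sum_nonneg fun i hi => (hf i hi).nonneg x, ?_⟩
  have : ∀ i, ∃ C, i ∈ s → ∀ x, f i x ≤ C := fun i => by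
    by_cases hi : i ∈ s
    · exact (hf i hi).bounded.imp fun C h _ => h
    · exact ⟨0, fun h => absurd h hi⟩
  choose C hC using this
  exact ⟨∑ i ∈ s, C i, fun x => Finset.sum_le_sum fun i hi => hC i hi x⟩

theorem IsBoundedWeight.pow_integral_le {X : Type*} [MeasurableSpace X] {f : X → ℝ}
    (hf : IsBoundedWeight f) (μ : Measure X) [IsProbabilityMeasure μ] (k : ℕ) :
    (∫ x, f x ∂μ) ^ k ≤ ∫ x, f x ^ k ∂μ := by
  have hk : IsBoundedWeight fun x => f x ^ k := by
    simpa using isBoundedWeight_prod (Finset.univ : Finset (Fin k)) (f := fun _ => f)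
      fun _ _ => hf
  exact (convexOn_pow k).map_integral_le (continuous_pow k).continuousOn isClosed_Ici
    (Filter.Eventually.of_forall hf.nonneg) (hf.integrable μ) (hk.integrable μ)

theorem rpow_one_div_pow {ι : Type*} (s : Finset ι) {a : ι → ℝ} (ha : ∀ i ∈ s, 0 ≤ a i) {k : ℕ}
    (hk : k ≠ 0) : (∏ i ∈ s, a i ^ (1 / (k : ℝ))) ^ k = ∏ i ∈ s, a i := by
  rw [← Finset.prod_pow]
  refine Finset.prod_congr rfl fun i hi => ?_
  rw [one_div, Real.rpow_inv_natCast_pow (ha i hi) hk]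

theorem tendsto_descFactorial_div_pow (k : ℕ) :
    Filter.Tendsto (fun n : ℕ => (n.descFactorial k : ℝ) / (n : ℝ) ^ k) Filter.atTop (nhds 1) := by
  have h := isEquivalent_descFactorial k
  refine (Asymptotics.isEquivalent_iff_tendsto_one ?_).1 h
  filter_upwards [Filter.eventually_gt_atTop 0] with n hn
  positivity

theorem card_filter_injective (V : Type*) [Fintype V] [DecidableEq V] (M : ℕ) :
    (Finset.univ.filter fun x : V → Fin M => Function.Injective x).card =
      M.descFactorial (Fintype.card V) := by
  classical
  rw [← Fintype.card_subtype, Fintype.card_congr (Equiv.subtypeInjectiveEquivEmbedding V (Fin M)),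
    Fintype.card_embedding_eq, Fintype.card_fin]

namespace Bigraph

variable {V₁ V₂ : Type*} [Fintype V₁] [Fintype V₂] [DecidableEq V₁] [DecidableEq V₂]
  {G : Bigraph V₁ V₂} {X Y : Type*} [MeasurableSpace X] [MeasurableSpace Y]

theorem isBoundedWeight_homWeight {f : V₁ → X → ℝ} {g : V₂ → Y → ℝ} {W : X × Y → ℝ}
    (hW : IsBoundedWeight W) (hf : ∀ v, IsBoundedWeight (f v)) (hg : ∀ w, IsBoundedWeight (g w)) :
    IsBoundedWeight fun p : (V₁ → X) × (V₂ → Y) => G.homWeight f g W p.1 p.2 := by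
  refine ((isBoundedWeight_prod _ fun v _ => ?_).mul (isBoundedWeight_prod _ fun w _ => ?_)).mul
    (isBoundedWeight_prod _ fun q _ => ?_)
  · exact (hf v).comp (φ := fun p : (V₁ → X) × (V₂ → Y) => p.1 v) (by fun_prop)
  · exact (hg w).comp (φ := fun p : (V₁ → X) × (V₂ → Y) => p.2 w) (by fun_prop)
  · exact hW.comp (φ := fun p : (V₁ → X) × (V₂ → Y) => (p.1 q.1, p.2 q.2)) (by fun_prop)

/-- Transfer of the finite inequality to `M` independent samples of each side. -/
theorem card_pow_mul_weightedEdgeDensity_pow_le (hG : G.NoIsolatedVertices)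
    (hd : ∀ k : ℕ, 2 ≤ k →
      G.numRightDegree k = 0 ∨ (Fintype.card V₁).choose k ≤ G.numRightDegree k)
    (he : G.e ≠ 0) {f : V₁ → X → ℝ} {g : V₂ → Y → ℝ} {W : X × Y → ℝ}
    (hW : IsBoundedWeight W) (hf : ∀ v, IsBoundedWeight (f v)) (hg : ∀ w, IsBoundedWeight (g w))
    (μ : Measure X) (ν : Measure Y) [IsProbabilityMeasure μ] [IsProbabilityMeasure ν]
    {M : ℕ} (hM : M ≠ 0) :
    (M : ℝ) ^ Fintype.card V₁ * (M : ℝ) ^ Fintype.card V₂ *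
        G.weightedEdgeDensity μ ν f g W ^ G.e ≤
      ∑ x : V₁ → Fin M, ∑ y : V₂ → Fin M, ∫ p : (Fin M → X) × (Fin M → Y),
        G.homWeight f g W (p.1 ∘ x) (p.2 ∘ y)
          ∂((Measure.pi fun _ => μ).prod (Measure.pi fun _ => ν)) := by
  have : NeZero M := ⟨hM⟩
  have hMpos : (0 : ℝ) < M := by exact_mod_cast Nat.pos_of_ne_zero hM
  set P := (Measure.pi fun _ : Fin M => μ).prod (Measure.pi fun _ : Fin M => ν)
  set F : X → ℝ := fun a => ∏ v, f v a ^ (1 / (G.e : ℝ)) with hF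
  set H : Y → ℝ := fun b => ∏ w, g w b ^ (1 / (G.e : ℝ)) with hH
  have hFb : IsBoundedWeight F := isBoundedWeight_prod _ fun v _ => (hf v).rpow (by positivity)
  have hHb : IsBoundedWeight H := isBoundedWeight_prod _ fun w _ => (hg w).rpow (by positivity)
  set φ : X × Y → ℝ := fun q => F q.1 * H q.2 * W q with hφ
  have hφb : IsBoundedWeight φ :=
    ((hFb.comp measurable_fst).mul (hHb.comp measurable_snd)).mul hW
  set Z : (Fin M → X) × (Fin M → Y) → ℝ := fun p =>
    ∑ q : Fin M × Fin M, φ (p.1 q.1, p.2 q.2) with hZ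
  have hterm : ∀ q : Fin M × Fin M, IsBoundedWeight
      fun p : (Fin M → X) × (Fin M → Y) => φ (p.1 q.1, p.2 q.2) := fun q =>
    hφb.comp (φ := fun p : (Fin M → X) × (Fin M → Y) => (p.1 q.1, p.2 q.2)) (by fun_prop)
  have hZb : IsBoundedWeight Z := isBoundedWeight_sum _ fun q _ => hterm q
  -- Every pair of sample points, one from each side, has law μ ⊗ ν, so all M² terms have the same
  -- mean.
  have hZint : ∫ p, Z p ∂P = (M : ℝ) ^ 2 * G.weightedEdgeDensity μ ν f g W := by
    rw [integral_finsetSum _ fun q _ => (hterm q).integrable P]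
    have : ∀ q : Fin M × Fin M, ∫ p, φ (p.1 q.1, p.2 q.2) ∂P =
        G.weightedEdgeDensity μ ν f g W := by
      intro q
      have hmp : MeasurePreserving (fun p : (Fin M → X) × (Fin M → Y) => (p.1 q.1, p.2 q.2)) P
          (μ.prod ν) := (measurePreserving_eval (fun _ : Fin M => μ) q.1).prod
        (measurePreserving_eval (fun _ : Fin M => ν) q.2)
      have := integral_map hmp.measurable.aemeasurable (μ := P) (f := φ)
        hφb.measurable.aestronglyMeasurable
      rw [hmp.map_eq] at this
      exact this.symm
    rw [Finset.sum_congr rfl fun q _ => this q, Finset.sum_const, Finset.card_univ]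
    simp [pow_two]
  have hhb : ∀ (x : V₁ → Fin M) (y : V₂ → Fin M), IsBoundedWeight
      fun p : (Fin M → X) × (Fin M → Y) => G.homWeight f g W (p.1 ∘ x) (p.2 ∘ y) := fun x y =>
    (isBoundedWeight_homWeight hW hf hg).comp
      (φ := fun p : (Fin M → X) × (Fin M → Y) => (p.1 ∘ x, p.2 ∘ y)) (by
        refine Measurable.prodMk ?_ ?_
        · exact measurable_pi_lambda _ fun v => (measurable_pi_apply _).comp measurable_fst
        · exact measurable_pi_lambda _ fun v => (measurable_pi_apply _).comp measurable_snd)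
  have hT : IsBoundedWeight fun p : (Fin M → X) × (Fin M → Y) =>
      ∑ x : V₁ → Fin M, ∑ y : V₂ → Fin M, G.homWeight f g W (p.1 ∘ x) (p.2 ∘ y) :=
    isBoundedWeight_sum _ fun x _ => isBoundedWeight_sum _ fun y _ => hhb x y
  have hZe : IsBoundedWeight fun p => Z p ^ G.e := by
    simpa using isBoundedWeight_prod (Finset.univ : Finset (Fin G.e)) (f := fun _ => Z)
      fun _ _ => hZb
  have hfin : ∀ p : (Fin M → X) × (Fin M → Y),
      (M : ℝ) ^ Fintype.card V₁ * (M : ℝ) ^ Fintype.card V₂ * Z p ^ G.e ≤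
        (M : ℝ) ^ G.e * (M : ℝ) ^ G.e *
          ∑ x : V₁ → Fin M, ∑ y : V₂ → Fin M, G.homWeight f g W (p.1 ∘ x) (p.2 ∘ y) := by
    intro p
    have := finite_strongSidorenko hG hd he (A := Fin M) (B := Fin M)
      (f := fun v i => f v (p.1 i)) (g := fun w i => g w (p.2 i))
      (W := fun q => W (p.1 q.1, p.2 q.2)) (F := fun i => F (p.1 i)) (H := fun i => H (p.2 i))
      (fun v _ => (hf v).nonneg _) (fun w _ => (hg w).nonneg _) (fun _ => hW.nonneg _)
      (fun _ => hFb.nonneg _) (fun _ => hHb.nonneg _)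
      (fun i => rpow_one_div_pow _ (fun v _ => (hf v).nonneg _) he)
      (fun i => rpow_one_div_pow _ (fun w _ => (hg w).nonneg _) he)
    rw [Fintype.card_fin] at this
    calc _ = Z p ^ G.e * (M : ℝ) ^ Fintype.card V₁ * (M : ℝ) ^ Fintype.card V₂ := by ring
      _ ≤ _ := this
      _ = (M : ℝ) ^ G.e * (M : ℝ) ^ G.e *
          ∑ x : V₁ → Fin M, ∑ y : V₂ → Fin M, G.homWeight (fun v i => f v (p.1 i))
            (fun w i => g w (p.2 i)) (fun q => W (p.1 q.1, p.2 q.2)) x y := by ring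
      _ = _ := rfl
  have hint := integral_mono ((hZe.integrable P).const_mul _) ((hT.integrable P).const_mul _) hfin
  simp only [integral_const_mul] at hint
  rw [integral_finsetSum _ fun x _ => (isBoundedWeight_sum _ fun y _ => hhb x y).integrable P]
    at hint
  simp_rw [integral_finsetSum _ fun y _ => (hhb _ y).integrable P] at hint
  -- The finite inequality holds for every sample; Jensen moves the power `G.e` outside the
  -- expectation of `Z`.
  have jensen := hZb.pow_integral_le P G.e
  rw [hZint] at jensen
  refine le_of_mul_le_mul_left ?_ (show (0 : ℝ) < (M : ℝ) ^ G.e * (M : ℝ) ^ G.e by positivity)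
  refine le_trans ?_ hint
  calc _ = (M : ℝ) ^ Fintype.card V₁ * (M : ℝ) ^ Fintype.card V₂ *
        ((M : ℝ) ^ 2 * G.weightedEdgeDensity μ ν f g W) ^ G.e := by ring
    _ ≤ _ := by gcongr

theorem integral_homWeight_comp_of_injective {f : V₁ → X → ℝ} {g : V₂ → Y → ℝ} {W : X × Y → ℝ}
    (hW : IsBoundedWeight W) (hf : ∀ v, IsBoundedWeight (f v)) (hg : ∀ w, IsBoundedWeight (g w))
    (μ : Measure X) (ν : Measure Y) [IsProbabilityMeasure μ] [IsProbabilityMeasure ν]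
    {M : ℕ} {x : V₁ → Fin M} {y : V₂ → Fin M} (hx : Function.Injective x)
    (hy : Function.Injective y) :
    ∫ p : (Fin M → X) × (Fin M → Y), G.homWeight f g W (p.1 ∘ x) (p.2 ∘ y)
      ∂((Measure.pi fun _ => μ).prod (Measure.pi fun _ => ν)) = G.weightedDensity μ ν f g W := by
  have hmp := (measurePreserving_comp_injective μ hx).prod (measurePreserving_comp_injective ν hy)
  have := integral_map (μ := (Measure.pi fun _ => μ).prod (Measure.pi fun _ => ν))
    hmp.measurable.aemeasurable
    (isBoundedWeight_homWeight (G := G) hW hf hg).measurable.aestronglyMeasurable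
  rw [hmp.map_eq] at this
  exact this.symm

/-- An injective pair of vertex maps into the sample contributes exactly the density t, any other
pair at most the uniform bound `C`. The proportion of injective pairs tends to 1 as `M` grows. -/
theorem weightedEdgeDensity_pow_le (hG : G.NoIsolatedVertices)
    (hd : ∀ k : ℕ, 2 ≤ k →
      G.numRightDegree k = 0 ∨ (Fintype.card V₁).choose k ≤ G.numRightDegree k)
    (he : G.e ≠ 0) {f : V₁ → X → ℝ} {g : V₂ → Y → ℝ} {W : X × Y → ℝ}
    (hW : IsBoundedWeight W) (hf : ∀ v, IsBoundedWeight (f v)) (hg : ∀ w, IsBoundedWeight (g w))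
    (μ : Measure X) (ν : Measure Y) [IsProbabilityMeasure μ] [IsProbabilityMeasure ν] :
    G.weightedEdgeDensity μ ν f g W ^ G.e ≤ G.weightedDensity μ ν f g W := by
  classical
  obtain ⟨C, hC⟩ := (isBoundedWeight_homWeight (G := G) hW hf hg).bounded
  set t := G.weightedDensity μ ν f g W
  set z := G.weightedEdgeDensity μ ν f g W ^ G.e
  have hbound : ∀ M : ℕ, M ≠ 0 →
      ((M.descFactorial (Fintype.card V₁) : ℝ) / (M : ℝ) ^ Fintype.card V₁) *
        ((M.descFactorial (Fintype.card V₂) : ℝ) / (M : ℝ) ^ Fintype.card V₂) * (C - t) ≤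
          C - z := by
    intro M hM
    have hMpos : (0 : ℝ) < M := by exact_mod_cast Nat.pos_of_ne_zero hM
    have h := card_pow_mul_weightedEdgeDensity_pow_le hG hd he hW hf hg μ ν hM
    have hle : ∀ (x : V₁ → Fin M) (y : V₂ → Fin M),
        ∫ p : (Fin M → X) × (Fin M → Y), G.homWeight f g W (p.1 ∘ x) (p.2 ∘ y)
          ∂((Measure.pi fun _ => μ).prod (Measure.pi fun _ => ν)) ≤
        C - (if Function.Injective x then 1 else 0) *
          ((if Function.Injective y then 1 else 0) * (C - t)) := by
      intro x y
      by_cases hxy : Function.Injective x ∧ Function.Injective y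
      · rw [integral_homWeight_comp_of_injective hW hf hg μ ν hxy.1 hxy.2, if_pos hxy.1,
          if_pos hxy.2]
        simp [t]
      · have h0 : ((if Function.Injective x then 1 else 0) *
          ((if Function.Injective y then 1 else 0) * (C - t)) : ℝ) = 0 := by
          rw [not_and_or] at hxy
          rcases hxy with h | h <;> simp [h]
        rw [h0, sub_zero]
        calc _ ≤ ∫ _ : (Fin M → X) × (Fin M → Y), C
              ∂((Measure.pi fun _ => μ).prod (Measure.pi fun _ => ν)) :=
              integral_mono_of_nonneg (Filter.Eventually.of_forall fun p =>
                (isBoundedWeight_homWeight hW hf hg).nonneg (p.1 ∘ x, p.2 ∘ y))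
                (integrable_const C)
                (Filter.Eventually.of_forall fun p => hC (p.1 ∘ x, p.2 ∘ y))
          _ = C := by simp
    have h2 := h.trans (Finset.sum_le_sum fun x _ => Finset.sum_le_sum fun y _ => hle x y)
    simp only [Finset.sum_sub_distrib, ← Finset.mul_sum, ← Finset.sum_mul, Finset.sum_boole,
      card_filter_injective, Finset.sum_const, Finset.card_univ, Fintype.card_fun,
      Fintype.card_fin, nsmul_eq_mul, Nat.cast_pow] at h2
    rw [div_mul_div_comm, div_mul_eq_mul_div, div_le_iff₀ (by positivity)]
    linarith
  have lim : Filter.Tendsto (fun M : ℕ =>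
      ((M.descFactorial (Fintype.card V₁) : ℝ) / (M : ℝ) ^ Fintype.card V₁) *
        ((M.descFactorial (Fintype.card V₂) : ℝ) / (M : ℝ) ^ Fintype.card V₂) * (C - t))
      Filter.atTop (nhds (1 * 1 * (C - t))) :=
    ((tendsto_descFactorial_div_pow _).mul (tendsto_descFactorial_div_pow _)).mul_const _
  have := le_of_tendsto lim ((Filter.eventually_ne_atTop 0).mono hbound)
  linarith

end Bigraph

end Sampling

theorem mainTheorem2 {V₁ : Type u₁} {V₂ : Type u₂} [Fintype V₁] [Fintype V₂]
    (G : Bigraph V₁ V₂) (hG : G.NoIsolatedVertices)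
    (hd : ∀ k : ℕ, 2 ≤ k →
      G.numRightDegree k = 0 ∨ (Fintype.card V₁).choose k ≤ G.numRightDegree k) :
    Bigraph.IsStrongSidorenko.{u₁, u₂, uX, uY} G := by
  classical
  intro X Y _ _ μ ν _ _ W f g hW hf hg
  -- Without edges or isolated vertices both sides are empty and the inequality reads 1 ≥ 1. The
  -- exponent 1 / e(G) is meaningful only in the other case.
  by_cases he : G.e = 0
  · have hE : G.E = ∅ := Finset.card_eq_zero.1 he
    have : IsEmpty V₁ := ⟨fun v => by simpa [hE] using hG.exists_right v⟩
    have : IsEmpty V₂ := ⟨fun w => by simpa [hE] using hG.exists_left w⟩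
    rw [he, pow_zero]
    simp [Bigraph.weightedDensity, hE]
  · exact Bigraph.weightedEdgeDensity_pow_le hG hd he hW hf hg μ ν
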